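/- **Notation.** For a real $d\times m$ matrix $B$ let $\|B\|_2$ be its operator norm for the Euclidean norms, $\sigma_{\max}(B)=\sigma_1\ge\cdots\ge\sigma_{\min(d,m)}=\sigma_{\min}(B)$ its singular values, and $\kappa(B)=\sigma_{\max}(B)/\sigma_{\min}(B)$. **Algorithm SPA**, on a real $n\times m$ matrix $B$ and a positive integer $r$. Start with $S=B$ and $\mathcal I=\emptyset$. While $|\mathcal I|<r$: choose an index $i^*$ for which the column $t=s_{i^*}$ of $S$ has maximal Euclidean norm, replace $S$ by $\bigl(I-tt^\top/\|t\|_2^2\bigr)S$ and $\mathcal I$ by $\mathcal I\cup\{i^*\}$. Output $\mathcal I$. **Preconditioned SPA**, on a real $d\times m$ matrix $B$ and a positive integer $r\le\min(d,m)$. 1. Take a singular value decomposition $B=U\Sigma V^\top$ ($U,V$ orthogonal, singular values $\sigma_1\ge\sigma_2\ge\cdots$), and put $P=\mathrm{diag}(\sigma_1,\dots,\sigma_r)(v_1,\dots,v_r)^\top\in\mathbb R^{r\times m}$, where $v_1,\dots,v_r$ are the first $r$ columns of $V$. 2. Let $L^*$ be an optimal solution of the problem: minimize $-\log\det L$ over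 all symmetric positive definite $L\in\mathbb R^{r\times r}$ with $p_i^\top Lp_i\le 1$ for every column $p_i$ of $P$. 3. Run SPA on $((L^*)^{1/2}P,\,r)$ and output the resulting index set. **Theorem.** Let $r\ge 2$, $A,N\in\mathbb R^{d\times m}$ and $\widetilde A=A+N$. Suppose that $A=F(I,K)\Pi$, where $F\in\mathbb R^{d\times r}$ has rank $r$, $I$ is the $r\times r$ identity matrix, $K\in\mathbb R^{r\times(m-r)}$ is entrywise nonnegative with all column sums at most $1$, and $\Pi$ is an $m\times m$ permutation matrix. Let $\varepsilon=\|N\|_2$ and suppose that $$\varepsilon\le\frac{\sigma_{\min}(F)}{1225\sqrt r}.$$ Then preconditioned SPA on the input $(\widetilde A,r)$ always terminates (all its steps can be carried out, in particular no division by zero occurs), whatever singular value decomposition is used and however ties between columns of maximal norm are broken; and every index set $\mathcal I$ that it returns has exactly $r$ elements, which can be ordered as $\mathcal I(1),\dots,\mathcal I(r)$ so that $$\|\widetilde a_{\mathcal I(j)}-f_j\|_2\le(432\,\kappa(F)+4)\,\varepsilon\qquad(j=1,\dots,r),$$ where $\widetilde a_i$ and $f_j$ denote the columns of $\widetilde A$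 and $F$. -/

import Mathlib

namespace PrecondSPA

open Matrix

noncomputable section

/-- The matrix 2-norm, i.e. the operator norm for the Euclidean norms. -/
def norm2 {d m : ℕ} (N : Matrix (Fin d) (Fin m) ℝ) : ℝ :=
  ‖LinearMap.toContinuousLinearMap (Matrix.toEuclideanLin N)‖

/-- The Euclidean norm of a column vector. -/
def vecNorm2 {d : ℕ} (v : Fin d → ℝ) : ℝ := ‖(WithLp.toLp 2 v : EuclideanSpace ℝ (Fin d))‖

/-- The largest singular value `σ₁`. (Mathlib's list of singular values is in descending order
and indexed from `0`.) -/
def sigmaMax {d m : ℕ} (A : Matrix (Fin d) (Fin m) ℝ) : ℝ :=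
  (Matrix.toEuclideanLin A).singularValues 0

/-- The smallest of the singular values `σ₁ ≥ ⋯ ≥ σ_t`, `t = min d m`. -/
def sigmaMin {d m : ℕ} (A : Matrix (Fin d) (Fin m) ℝ) : ℝ :=
  (Matrix.toEuclideanLin A).singularValues (min d m - 1)

/-- The condition number `κ(A) = σ_max(A) / σ_min(A)`. -/
def cond {d m : ℕ} (A : Matrix (Fin d) (Fin m) ℝ) : ℝ := sigmaMax A / sigmaMin A

/-- The `r × m` matrix `(I, K)`. -/
def identityBeside {r m : ℕ} (hrm : r ≤ m) (K : Matrix (Fin r) (Fin (m - r)) ℝ) :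
    Matrix (Fin r) (Fin m) ℝ :=
  (Matrix.fromCols (1 : Matrix (Fin r) (Fin r) ℝ) K).submatrix id
    (finSumFinEquiv.trans (finCongr (Nat.add_sub_cancel' hrm))).symm

/-- `A = F (I, K) Π` with `K` nonnegative and `Π` a permutation matrix, where `F` has rank `r` and
the column sums of `K` are at most one. -/
def IsSeparable {d m r : ℕ} (A : Matrix (Fin d) (Fin m) ℝ) (F : Matrix (Fin d) (Fin r) ℝ) : Prop :=
  ∃ (hrm : r ≤ m) (K : Matrix (Fin r) (Fin (m - r)) ℝ) (π : Equiv.Perm (Fin m)),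
    A = F * (identityBeside hrm K * π.permMatrix ℝ) ∧
    (∀ i j, 0 ≤ K i j) ∧
    F.rank = r ∧
    ∀ j, ∑ i, K i j ≤ 1

/-! ### The successive projection algorithm (SPA) -/

/-- A state of SPA: the current matrix `S` and the current index set. -/
structure SPAState (n m : ℕ) where
  S : Matrix (Fin n) (Fin m) ℝ
  I : Finset (Fin m)

/-- One pass through the loop of SPA, which is entered only when fewer than `r` indices have been
found. Any column `t` of `S` of maximal norm may be selected. There is no successor if `t = 0`, as
then the projection `1 - t tᵀ / ‖t‖²` is undefined. -/
def SPAStep {n m : ℕ} (r : ℕ) (s s' : SPAState n m) : Prop :=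
  s.I.card < r ∧
  ∃ i : Fin m,
    (∀ k, s.S.col k ⬝ᵥ s.S.col k ≤ s.S.col i ⬝ᵥ s.S.col i) ∧
    s.S.col i ≠ 0 ∧
    s'.S = (1 - (s.S.col i ⬝ᵥ s.S.col i)⁻¹ • vecMulVec (s.S.col i) (s.S.col i)) * s.S ∧
    s'.I = insert i s.I

/-- The states that a run of SPA on the input `(A, r)` can reach. -/
def SPAReaches {n m : ℕ} (A : Matrix (Fin n) (Fin m) ℝ) (r : ℕ) (s : SPAState n m) : Prop :=
  Relation.ReflTransGen (SPAStep r) ⟨A, ∅⟩ s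

/-- Some run of SPA on `(A, r)` stops regularly with the output `I`. -/
def SPAReturns {n m : ℕ} (A : Matrix (Fin n) (Fin m) ℝ) (r : ℕ) (I : Finset (Fin m)) : Prop :=
  ∃ S, SPAReaches A r ⟨S, I⟩ ∧ r ≤ I.card

/-- Every run of SPA on `(A, r)`, whatever the choice among columns of equal norm, stops regularly:
no run is infinite, and none gets stuck before `r` indices have been found. -/
def SPATerminates {n m : ℕ} (A : Matrix (Fin n) (Fin m) ℝ) (r : ℕ) : Prop :=
  (¬ ∃ run : ℕ → SPAState n m, run 0 = ⟨A, ∅⟩ ∧ ∀ k, SPAStep r (run k) (run (k + 1))) ∧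
  ∀ s, SPAReaches A r s → s.I.card < r → ∃ s', SPAStep r s s'

/-! ### The preconditioned SPA -/

/-- The `d × m` diagonal matrix with diagonal entries `σ`. -/
def rectDiagonal {d m : ℕ} (σ : Fin (min d m) → ℝ) : Matrix (Fin d) (Fin m) ℝ :=
  Matrix.of fun i j =>
    if h : (i : ℕ) = j then σ ⟨i, lt_min i.isLt (h ▸ j.isLt)⟩ else 0

/-- `A = U Σ Vᵀ` is a singular value decomposition with singular values in descending order. -/
def IsSVD {d m : ℕ} (A : Matrix (Fin d) (Fin m) ℝ) (U : Matrix (Fin d) (Fin d) ℝ)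
    (σ : Fin (min d m) → ℝ) (V : Matrix (Fin m) (Fin m) ℝ) : Prop :=
  U ∈ Matrix.orthogonalGroup (Fin d) ℝ ∧ V ∈ Matrix.orthogonalGroup (Fin m) ℝ ∧
  (∀ k, 0 ≤ σ k) ∧ Antitone σ ∧ A = U * rectDiagonal σ * Vᵀ

/-- `P = diag(σ₁, …, σ_r) (v₁, …, v_r)ᵀ` for some singular value decomposition of `A`. -/
def IsTruncatedSVD {d m : ℕ} (A : Matrix (Fin d) (Fin m) ℝ) (r : ℕ)
    (P : Matrix (Fin r) (Fin m) ℝ) : Prop :=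
  ∃ (U : Matrix (Fin d) (Fin d) ℝ) (σ : Fin (min d m) → ℝ) (V : Matrix (Fin m) (Fin m) ℝ)
    (hr : r ≤ min d m),
    IsSVD A U σ V ∧
    P = Matrix.diagonal (fun k : Fin r => σ (Fin.castLE hr k)) *
      (V.submatrix id (Fin.castLE (hr.trans (min_le_right d m))))ᵀ

/-- `L` is feasible for the problem of the origin-centred minimum volume enclosing ellipsoid of the
set `𝒮`. -/
def MVEEFeasible {n : ℕ} (𝒮 : Set (Fin n → ℝ)) (L : Matrix (Fin n) (Fin n) ℝ) : Prop :=
  L.PosDef ∧ ∀ a ∈ 𝒮, a ⬝ᵥ (L *ᵥ a) ≤ 1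

/-- `L` minimizes `-log det` over the feasible matrices. -/
def MVEEOptimal {n : ℕ} (𝒮 : Set (Fin n → ℝ)) (L : Matrix (Fin n) (Fin n) ℝ) : Prop :=
  MVEEFeasible 𝒮 L ∧ ∀ L', MVEEFeasible 𝒮 L' → -Real.log L.det ≤ -Real.log L'.det

/-- The square root `U diag(λ₁^{1/2}, …, λ_n^{1/2}) Uᵀ` of `L = U diag(λ₁, …, λ_n) Uᵀ`. -/
def sqrtMatrix {n : ℕ} (L : Matrix (Fin n) (Fin n) ℝ) (hL : L.PosDef) :
    Matrix (Fin n) (Fin n) ℝ :=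
  (hL.isHermitian.eigenvectorUnitary : Matrix (Fin n) (Fin n) ℝ) *
    Matrix.diagonal (fun i => √(hL.isHermitian.eigenvalues i)) *
    (hL.isHermitian.eigenvectorUnitary : Matrix (Fin n) (Fin n) ℝ)ᵀ

/-- Some run of the preconditioned SPA on `(A, r)` stops regularly with the output `I`. -/
def Returns {d m : ℕ} (A : Matrix (Fin d) (Fin m) ℝ) (r : ℕ) (I : Finset (Fin m)) : Prop :=
  ∃ P : Matrix (Fin r) (Fin m) ℝ, IsTruncatedSVD A r P ∧
    ∃ (L : Matrix (Fin r) (Fin r) ℝ) (hL : MVEEOptimal (Set.range P.col) L),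
      SPAReturns (sqrtMatrix L hL.1.1 * P) r I

/-- Every run of the preconditioned SPA on `(A, r)` stops regularly: step 1 can be carried out;
whatever singular value decomposition is used in it, the optimization problem of step 2 is
solvable; and with every solution of it, every run of SPA in step 3 stops regularly. -/
def Terminates {d m : ℕ} (A : Matrix (Fin d) (Fin m) ℝ) (r : ℕ) : Prop :=
  (∃ P : Matrix (Fin r) (Fin m) ℝ, IsTruncatedSVD A r P) ∧
  ∀ P : Matrix (Fin r) (Fin m) ℝ, IsTruncatedSVD A r P →
    (∃ L, MVEEOptimal (Set.range P.col) L) ∧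
    ∀ (L : Matrix (Fin r) (Fin r) ℝ) (hL : MVEEOptimal (Set.range P.col) L),
      SPATerminates (sqrtMatrix L hL.1.1 * P) r

end

end PrecondSPA

/-! Let `R` consist of the first `r` left singular vectors of `Ã`, so that `P = Rᵀ Ã`. By
Eckart–Young, `Ã - R P` has norm at most `ε`, and `P` is, up to noise, separable with vertices the
columns of `G = Rᵀ F`. John's optimality conditions for the minimum volume ellipsoid say that, after
preconditioning, the points on the unit sphere carry weights that make them a tight frame. All
points lie in the unit ball and are subconvex combinations of the vertices up to noise, so those on
the sphere put almost all of their weight on the vertices near them. Hence the preconditioned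
vertices nearly form a tight frame themselves: they are nearly orthonormal, however ill-conditioned
`F` is. For such vertices every step of SPA selects a column close to a vertex that has not been
found yet, and the error does not accumulate. It is measured in the coordinates in which the
vertices are unit vectors, where the noise has size about `ε / σ_min(F)`; the way back to the
columns of `F` costs a factor `σ_max(F)`, which gives `κ(F)`. -/

open scoped InnerProductSpace

namespace PrecondSPA

open Matrix

noncomputable section

/-! ### Weights -/

section WeightedNorm

variable {ι : Type*} [Fintype ι] {u a b : ι → ℝ}

/-- The `ℓ²` norm of `a` with weights `u`, which are meant to be nonnegative. -/
def wnorm (u a : ι → ℝ) : ℝ := ‖(WithLp.toLp 2 fun i => √(u i) * a i : EuclideanSpace ℝ ι)‖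

theorem wnorm_nonneg : 0 ≤ wnorm u a := norm_nonneg _

theorem sq_wnorm (hu : ∀ i, 0 ≤ u i) : wnorm u a ^ 2 = ∑ i, u i * a i ^ 2 := by
  simp only [wnorm, EuclideanSpace.real_norm_sq_eq, mul_pow, Real.sq_sqrt (hu _)]

theorem wnorm_add_le : wnorm u (a + b) ≤ wnorm u a + wnorm u b := by
  simpa only [wnorm, Pi.add_def, mul_add, ← WithLp.toLp_add] using norm_add_le
    (WithLp.toLp 2 fun i => √(u i) * a i : EuclideanSpace ℝ ι) (WithLp.toLp 2 fun i => √(u i) * b i)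

theorem wnorm_sub_le : wnorm u (a - b) ≤ wnorm u a + wnorm u b := by
  simpa only [wnorm, Pi.sub_def, mul_sub, ← WithLp.toLp_sub] using norm_sub_le
    (WithLp.toLp 2 fun i => √(u i) * a i : EuclideanSpace ℝ ι) (WithLp.toLp 2 fun i => √(u i) * b i)

theorem wnorm_le_of_sum_le (hu : ∀ i, 0 ≤ u i) {c : ℝ} (hc : 0 ≤ c)
    (h : ∑ i, u i * a i ^ 2 ≤ c ^ 2) : wnorm u a ≤ c :=
  le_of_sq_le_sq ((sq_wnorm hu).trans_le h) hc

theorem le_wnorm_of_le_sum (hu : ∀ i, 0 ≤ u i) {c : ℝ} (h : c ^ 2 ≤ ∑ i, u i * a i ^ 2) :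
    c ≤ wnorm u a :=
  le_of_sq_le_sq (h.trans_eq (sq_wnorm hu).symm) wnorm_nonneg

theorem wnorm_le_wnorm_of_abs_le (hu : ∀ i, 0 ≤ u i) (h : ∀ i, u i ≠ 0 → |a i| ≤ b i) :
    wnorm u a ≤ wnorm u b := by
  refine wnorm_le_of_sum_le hu wnorm_nonneg ?_
  rw [sq_wnorm hu]
  refine Finset.sum_le_sum fun i _ => ?_
  rcases eq_or_ne (u i) 0 with hi | hi
  · simp [hi]
  · exact mul_le_mul_of_nonneg_left (sq_le_sq.2 ((h i hi).trans (le_abs_self _))) (hu i)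

theorem wnorm_smul {c : ℝ} (hc : 0 ≤ c) : wnorm u (c • a) = c * wnorm u a := by
  rw [wnorm, wnorm, ← Real.norm_of_nonneg hc, ← norm_smul, Real.norm_of_nonneg hc]
  congr 1
  ext i
  simp [mul_left_comm]

end WeightedNorm

section Weights

variable {κ : Type*} {w : κ → ℝ}

/-- The part of the weights `w` that sits at the indices where `a` is at least `c`. -/
def weightAbove (w a : κ → ℝ) (c : ℝ) (j : κ) : ℝ := if c ≤ a j then w j else 0

theorem weightAbove_nonneg (hw : ∀ j, 0 ≤ w j) (a : κ → ℝ) (c : ℝ) (j : κ) :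
    0 ≤ weightAbove w a c j := by
  unfold weightAbove
  split_ifs
  exacts [hw j, le_rfl]

theorem weightAbove_le (hw : ∀ j, 0 ≤ w j) (a : κ → ℝ) (c : ℝ) (j : κ) :
    weightAbove w a c j ≤ w j := by
  unfold weightAbove
  split_ifs
  exacts [le_rfl, hw j]

theorem le_of_weightAbove_ne_zero {a : κ → ℝ} {c : ℝ} {j : κ} (h : weightAbove w a c j ≠ 0) :
    c ≤ a j :=
  (ite_ne_right_iff.1 h).1

variable [Fintype κ]

theorem sq_sum_mul_le_sum_mul_sq (hw : ∀ j, 0 ≤ w j) (hw1 : ∑ j, w j ≤ 1) (z : κ → ℝ) :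
    (∑ j, w j * z j) ^ 2 ≤ ∑ j, w j * z j ^ 2 := by
  have hnonneg : ∀ j, 0 ≤ w j * z j ^ 2 := fun j => mul_nonneg (hw j) (sq_nonneg _)
  refine (Finset.sum_sq_le_sum_mul_sum_of_sq_le_mul _ (fun j _ => hw j) (fun j _ => hnonneg j)
    fun j _ => le_of_eq (by ring)).trans ?_
  exact mul_le_of_le_one_left (Finset.sum_nonneg fun j _ => hnonneg j) hw1

theorem abs_le_sqrt_sum_sq (z : κ → ℝ) (j : κ) : |z j| ≤ √(∑ j, z j ^ 2) :=
  Real.abs_le_sqrt (Finset.single_le_sum (f := fun j => z j ^ 2) (fun _ _ => sq_nonneg _)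
    (Finset.mem_univ j))

theorem sq_sum_eq_sum_sq_of_subsingleton {f : κ → ℝ} (hf : ∀ j k, f j ≠ 0 → f k ≠ 0 → j = k) :
    (∑ j, f j) ^ 2 = ∑ j, f j ^ 2 := by
  by_cases h : ∃ l, f l ≠ 0
  · obtain ⟨l, hl⟩ := h
    have hzero : ∀ j ≠ l, f j = 0 := fun j hj => by_contra fun h => hj (hf j l h hl)
    rw [Fintype.sum_eq_single l hzero, Fintype.sum_eq_single l fun j hj => by simp [hzero j hj]]
  · push Not at h
    simp [h]

/-- Markov's inequality: weights whose mean of `a` is close to the maximal possible value `m` sit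
mostly where `a` is large. -/
theorem mul_one_sub_sum_weightAbove_le (hw : ∀ j, 0 ≤ w j) (hw1 : ∑ j, w j ≤ 1) {a δ : κ → ℝ}
    {m c : ℝ} (hc : 0 ≤ c) (hδ : ∀ j, 0 ≤ δ j) (ha : ∀ j, a j ≤ m + δ j) :
    (m - c) * (1 - ∑ j, weightAbove w a c j) ≤ m + ∑ j, w j * δ j - ∑ j, w j * a j := by
  have hterm : ∀ j, w j * a j ≤ (m - c) * weightAbove w a c j + c * w j + w j * δ j := by
    intro j
    unfold weightAbove
    split_ifs with hj
    · linarith [mul_le_mul_of_nonneg_left (ha j) (hw j)]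
    · have := mul_le_mul_of_nonneg_left ((not_le.1 hj).le.trans (le_add_of_nonneg_right (hδ j)))
        (hw j)
      linarith
  have hsum := Finset.sum_le_sum fun j (_ : j ∈ Finset.univ) => hterm j
  rw [Finset.sum_add_distrib, Finset.sum_add_distrib, ← Finset.mul_sum, ← Finset.mul_sum] at hsum
  linarith [mul_le_mul_of_nonneg_left hw1 hc]

end Weights

/-! ### Subconvex combinations and analysis maps -/

section InnerProduct

variable {κ V : Type*} [NormedAddCommGroup V] [InnerProductSpace ℝ V]

theorem norm_sub_sq_le_of_le_inner {x a b : V} {m c : ℝ} (hx : ‖x‖ = 1) (ha : ‖a‖ ≤ m)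
    (hb : ‖b‖ ≤ m) (hc : 0 ≤ c) (hax : c ≤ ⟪a, x⟫_ℝ) (hbx : c ≤ ⟪b, x⟫_ℝ) :
    ‖a - b‖ ^ 2 ≤ 4 * m ^ 2 - 4 * c ^ 2 := by
  have hadd : 2 * c ≤ ‖a + b‖ := by
    have := real_inner_le_norm (a + b) x
    rw [inner_add_left, hx, mul_one] at this
    linarith
  nlinarith [parallelogram_law_with_norm ℝ a b, norm_nonneg a, norm_nonneg b]

/-- The analysis map of the family `q`, in the sense of frame theory. -/
def analysis (q : κ → V) (v : V) (j : κ) : ℝ := ⟪q j, v⟫_ℝ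

variable [Fintype κ] {q : κ → V} {w : κ → ℝ} {m c : ℝ}

theorem two_mul_sq_le_norm_sub_sq [DecidableEq κ] {j k : κ} (hjk : j ≠ k) (hc : 0 ≤ c)
    (h : c * √(∑ l, (Pi.single j 1 - Pi.single k 1 : κ → ℝ) l ^ 2) ≤
      ‖∑ l, (Pi.single j 1 - Pi.single k 1 : κ → ℝ) l • q l‖) :
    2 * c ^ 2 ≤ ‖q j - q k‖ ^ 2 := by
  have hcoeff : ∑ l, (Pi.single j 1 - Pi.single k 1 : κ → ℝ) l ^ 2 = 2 := by
    simp only [Pi.sub_apply, sub_sq, Finset.sum_add_distrib, Finset.sum_sub_distrib]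
    simp [Pi.single_apply, ite_pow, hjk.symm]
    norm_num
  have hsum : ∑ l, (Pi.single j 1 - Pi.single k 1 : κ → ℝ) l • q l = q j - q k := by
    simp [sub_smul, Finset.sum_sub_distrib, Pi.single_apply]
  rw [hcoeff, hsum] at h
  calc 2 * c ^ 2 = (c * √2) ^ 2 := by rw [mul_pow, Real.sq_sqrt zero_le_two, mul_comm]
    _ ≤ ‖q j - q k‖ ^ 2 := pow_le_pow_left₀ (by positivity) h 2

theorem norm_sum_smul_sub_le (hq : ∀ j, ‖q j‖ ≤ m) (hw : ∀ j, 0 ≤ w j) (hw1 : ∑ j, w j ≤ 1)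
    (l : κ) : ‖∑ j, w j • q j - q l‖ ≤ 2 * m * (1 - w l) := by
  classical
  rw [← Finset.add_sum_erase _ _ (Finset.mem_univ l)] at hw1 ⊢
  have hsplit : w l • q l + ∑ j ∈ Finset.univ.erase l, w j • q j - q l
      = ∑ j ∈ Finset.univ.erase l, w j • q j - (1 - w l) • q l := by
    rw [sub_smul, one_smul]
    abel
  have hrest : 0 ≤ ∑ j ∈ Finset.univ.erase l, w j := Finset.sum_nonneg fun j _ => hw j
  have hsum : ‖∑ j ∈ Finset.univ.erase l, w j • q j‖ ≤ (∑ j ∈ Finset.univ.erase l, w j) * m := by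
    rw [Finset.sum_mul]
    refine norm_sum_le_of_le _ fun j _ => ?_
    rw [norm_smul, Real.norm_of_nonneg (hw j)]
    exact mul_le_mul_of_nonneg_left (hq j) (hw j)
  have hl : ‖(1 - w l) • q l‖ ≤ (1 - w l) * m := by
    rw [norm_smul, Real.norm_of_nonneg (by linarith)]
    exact mul_le_mul_of_nonneg_left (hq l) (by linarith)
  rw [hsplit]
  refine (norm_sub_le _ _).trans ?_
  nlinarith [(norm_nonneg _).trans (hq l)]

/-- A subconvex combination of points in a ball that is nearly as long as the radius is dominated
by a single point, provided the long points are well separated: those that have a large inner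
product with the combination would otherwise be too close together. -/
theorem exists_dominant_weight (hw : ∀ j, 0 ≤ w j) (hw1 : ∑ j, w j ≤ 1) (hq : ∀ j, ‖q j‖ ≤ m)
    (hc : 0 ≤ c) (hlt : c < ‖∑ j, w j • q j‖)
    (hsep : ∀ j k, j ≠ k → c ≤ ‖q j‖ → c ≤ ‖q k‖ → 4 * m ^ 2 - 4 * c ^ 2 < ‖q j - q k‖ ^ 2) :
    ∃ l, c ≤ ‖q l‖ ∧ (m - c) * (1 - w l) ≤ m - ‖∑ j, w j • q j‖ := by
  set x := ∑ j, w j • q j with hx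
  have hx0 : 0 < ‖x‖ := hc.trans_lt hlt
  obtain ⟨e, he, hxe⟩ : ∃ e : V, ‖e‖ = 1 ∧ ⟪x, e⟫_ℝ = ‖x‖ := by
    refine ⟨‖x‖⁻¹ • x, norm_smul_inv_norm (norm_pos_iff.1 hx0), ?_⟩
    rw [real_inner_smul_right, real_inner_self_eq_norm_sq]
    field_simp
  set a := analysis q e
  have hmean : ∑ j, w j * a j = ‖x‖ := by
    rw [← hxe, hx, sum_inner]
    simp only [real_inner_smul_left, a, analysis]
  have ha_le : ∀ j, a j ≤ ‖q j‖ := fun j => by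
    simpa only [a, analysis, he, mul_one] using real_inner_le_norm (q j) e
  have hunique : ∀ j k, c ≤ a j → c ≤ a k → j = k := fun j k hj hk => by
    by_contra hjk
    exact (hsep j k hjk (hj.trans (ha_le j)) (hk.trans (ha_le k))).not_ge
      (norm_sub_sq_le_of_le_inner he (hq j) (hq k) hc hj hk)
  have hmarkov := mul_one_sub_sum_weightAbove_le hw hw1 (δ := 0) hc (fun _ => le_rfl)
    (fun j => by simpa using (ha_le j).trans (hq j))
  simp only [Pi.zero_apply, mul_zero, Finset.sum_const_zero, add_zero, hmean] at hmarkov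
  by_cases hl : ∃ l, c ≤ a l
  · obtain ⟨l, hl⟩ := hl
    refine ⟨l, hl.trans (ha_le l), ?_⟩
    simp only [weightAbove] at hmarkov
    rwa [Fintype.sum_eq_single l fun j hj => if_neg fun h => hj (hunique j l h hl),
      if_pos hl] at hmarkov
  · push Not at hl
    simp only [weightAbove, (hl _).not_ge, if_false, Finset.sum_const_zero] at hmarkov
    linarith

theorem norm_sum_smul_le_of_analysis_le (hc : 0 ≤ c)
    (h : ∀ v, √(∑ j, analysis q v j ^ 2) ≤ c * ‖v‖) (z : κ → ℝ) :
    ‖∑ j, z j • q j‖ ≤ c * √(∑ j, z j ^ 2) := by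
  set x := ∑ j, z j • q j with hx
  have hself : ‖x‖ ^ 2 = ∑ j, z j * analysis q x j := by
    rw [← real_inner_self_eq_norm_sq]
    conv_lhs => rw [hx, sum_inner]
    simp only [real_inner_smul_left, analysis, hx]
  have hcauchy := Real.sum_mul_le_sqrt_mul_sqrt Finset.univ z (analysis q x)
  rcases (norm_nonneg x).eq_or_lt with h0 | h0
  · rw [← h0]
    positivity
  · nlinarith [h x, Real.sqrt_nonneg (∑ j, z j ^ 2)]

variable [FiniteDimensional ℝ V]

theorem exists_analysis_eq (hV : Module.finrank ℝ V = Fintype.card κ)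
    (hq : ∀ v, analysis q v = 0 → v = 0) (z : κ → ℝ) : ∃ v, analysis q v = z :=
  let T : V →ₗ[ℝ] κ → ℝ := LinearMap.pi fun j => (innerSL ℝ (q j)).toLinearMap
  (LinearMap.injective_iff_surjective_of_finrank_eq_finrank (f := T)
    (by rw [hV, Module.finrank_fintype_fun_eq_card])).1 ((injective_iff_map_eq_zero T).2 hq) z

theorem exists_analysis_eq_of_le_analysis (hV : Module.finrank ℝ V = Fintype.card κ) (hc : 0 < c)
    (h : ∀ v, c * ‖v‖ ≤ √(∑ j, analysis q v j ^ 2)) (z : κ → ℝ) : ∃ v, analysis q v = z := by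
  refine exists_analysis_eq hV (fun v hv => ?_) z
  have hle := h v
  simp only [hv, Pi.zero_apply, ne_eq, two_ne_zero, not_false_eq_true, zero_pow,
    Finset.sum_const_zero, Real.sqrt_zero] at hle
  exact norm_le_zero_iff.1 (nonpos_of_mul_nonpos_right hle hc)

theorem le_norm_sum_smul_of_le_analysis (hV : Module.finrank ℝ V = Fintype.card κ) (hc : 0 < c)
    (h : ∀ v, c * ‖v‖ ≤ √(∑ j, analysis q v j ^ 2)) (z : κ → ℝ) :
    c * √(∑ j, z j ^ 2) ≤ ‖∑ j, z j • q j‖ := by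
  obtain ⟨v, rfl⟩ := exists_analysis_eq_of_le_analysis hV hc h z
  have hv := h v
  set s := √(∑ j, analysis q v j ^ 2)
  have hsq : s ^ 2 = ∑ j, analysis q v j ^ 2 :=
    Real.sq_sqrt (Finset.sum_nonneg fun _ _ => sq_nonneg _)
  have hinner : ⟪∑ j, analysis q v j • q j, v⟫_ℝ = s ^ 2 := by
    rw [hsq, sum_inner]
    simp only [real_inner_smul_left, sq, analysis]
  have hcauchy := real_inner_le_norm (∑ j, analysis q v j • q j) v
  rw [hinner] at hcauchy
  have hs : 0 ≤ s := Real.sqrt_nonneg _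
  rcases hs.eq_or_lt with h0 | h0
  · simp [← h0]
  · refine le_of_mul_le_mul_left ?_ h0
    nlinarith [norm_nonneg (∑ j, analysis q v j • q j)]

end InnerProduct

/-! ### Noisy tight frames in a simplex -/

/-- The points `y i` lie in the unit ball and are, up to the noise `ν`, subconvex combinations of
the vertices `q j`. The vertices occur among them, and the weights `u`, which live on points of norm
one, turn them into a tight frame. By John's theorem this is the situation after preconditioning
with the minimum volume enclosing ellipsoid. -/
structure IsNoisyFrame {ι κ V : Type*} [Fintype ι] [Fintype κ] [NormedAddCommGroup V]
    [InnerProductSpace ℝ V] (q : κ → V) (y ν : ι → V) (w : Matrix ι κ ℝ) (u : ι → ℝ) (τ : κ → ι) :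
    Prop where
  weight_nonneg : ∀ i j, 0 ≤ w i j
  weight_sum : ∀ i, ∑ j, w i j ≤ 1
  eq_comb : ∀ i, y i = ∑ j, w i j • q j + ν i
  vertex : ∀ j, y (τ j) = q j + ν (τ j)
  injective : Function.Injective τ
  norm_le : ∀ i, ‖y i‖ ≤ 1
  nonneg : ∀ i, 0 ≤ u i
  active : ∀ i, u i ≠ 0 → ‖y i‖ = 1
  frame : ∀ v, ∑ i, u i * analysis y v i ^ 2 = ‖v‖ ^ 2
  noise : ∑ i, ‖ν i‖ ^ 2 ≤ (1 / 1000) ^ 2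

/-- The part of the weights that joins each point to the vertices near it. -/
def nearWeight {ι κ V : Type*} [NormedAddCommGroup V] [InnerProductSpace ℝ V] (q : κ → V)
    (y : ι → V) (w : Matrix ι κ ℝ) : Matrix ι κ ℝ :=
  fun i => weightAbove (w i) (analysis q (y i)) (9 / 10)

theorem le_inner_of_nearWeight_ne_zero {ι κ V : Type*} [NormedAddCommGroup V]
    [InnerProductSpace ℝ V] {q : κ → V} {y : ι → V} {w : Matrix ι κ ℝ} {i : ι} {j : κ}
    (h : nearWeight q y w i j ≠ 0) : 9 / 10 ≤ ⟪q j, y i⟫_ℝ :=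
  le_of_weightAbove_ne_zero (a := analysis q (y i)) h

/-- The noise of each point together with the noise that it inherits from the vertices. -/
def defect {ι κ V : Type*} [Fintype κ] [NormedAddCommGroup V] (ν : ι → V) (w : Matrix ι κ ℝ)
    (τ : κ → ι) : ι → ℝ :=
  (fun i => ‖ν i‖) + w *ᵥ fun j => ‖ν (τ j)‖

namespace IsNoisyFrame

variable {ι κ V : Type*} [Fintype ι] [Fintype κ] [NormedAddCommGroup V] [InnerProductSpace ℝ V]
  {q : κ → V} {y ν : ι → V} {w : Matrix ι κ ℝ} {u : ι → ℝ} {τ : κ → ι}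

theorem norm_noise_le (h : IsNoisyFrame q y ν w u τ) (i : ι) : ‖ν i‖ ≤ 1 / 1000 :=
  le_of_sq_le_sq ((Finset.single_le_sum (f := fun i => ‖ν i‖ ^ 2)
    (fun _ _ => sq_nonneg _) (Finset.mem_univ i)).trans h.noise) (by norm_num)

theorem norm_vertex_le (h : IsNoisyFrame q y ν w u τ) (j : κ) : ‖q j‖ ≤ 1 + ‖ν (τ j)‖ := by
  rw [eq_sub_of_add_eq (h.vertex j).symm]
  exact (norm_sub_le _ _).trans (by linarith [h.norm_le (τ j)])

theorem norm_vertex_le_const (h : IsNoisyFrame q y ν w u τ) (j : κ) : ‖q j‖ ≤ 1001 / 1000 := by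
  linarith [h.norm_vertex_le j, h.norm_noise_le (τ j)]

theorem weight_le_one (h : IsNoisyFrame q y ν w u τ) (i : ι) (j : κ) : w i j ≤ 1 :=
  (Finset.single_le_sum (fun k _ => h.weight_nonneg i k) (Finset.mem_univ j)).trans
    (h.weight_sum i)

theorem frameWeight_le_one (h : IsNoisyFrame q y ν w u τ) (i : ι) : u i ≤ 1 := by
  by_cases hi : u i = 0
  · simp [hi]
  have hterm : u i * analysis y (y i) i ^ 2 ≤ ∑ k, u k * analysis y (y i) k ^ 2 :=
    Finset.single_le_sum (fun k _ => mul_nonneg (h.nonneg k) (sq_nonneg _)) (Finset.mem_univ i)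
  rw [h.frame, analysis, real_inner_self_eq_norm_sq, h.active i hi] at hterm
  linarith

theorem nearWeight_nonneg (h : IsNoisyFrame q y ν w u τ) (i : ι) (j : κ) :
    0 ≤ nearWeight q y w i j :=
  weightAbove_nonneg (h.weight_nonneg i) _ _ j

theorem nearWeight_le (h : IsNoisyFrame q y ν w u τ) (i : ι) (j : κ) :
    nearWeight q y w i j ≤ w i j :=
  weightAbove_le (h.weight_nonneg i) _ _ j

theorem analysis_eq (h : IsNoisyFrame q y ν w u τ) (v : V) :
    analysis y v = w *ᵥ analysis q v + analysis ν v := by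
  ext i
  simp only [analysis, h.eq_comb i, inner_add_left, sum_inner, real_inner_smul_left,
    Pi.add_apply, mulVec, dotProduct]

theorem wnorm_analysis (h : IsNoisyFrame q y ν w u τ) (v : V) : wnorm u (analysis y v) = ‖v‖ := by
  rw [← sq_eq_sq₀ wnorm_nonneg (norm_nonneg v), sq_wnorm h.nonneg, h.frame]

theorem sum_farWeight_le (h : IsNoisyFrame q y ν w u τ) {i : ι} (hi : u i ≠ 0) :
    ∑ j, (w i j - nearWeight q y w i j) ≤ 10 * defect ν w τ i := by
  have hself : 1 = ∑ j, w i j * analysis q (y i) j + analysis ν (y i) i := by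
    have := congrFun (h.analysis_eq (y i)) i
    rwa [analysis, real_inner_self_eq_norm_sq, h.active i hi, one_pow] at this
  have hnoise := real_inner_le_norm (ν i) (y i)
  rw [h.active i hi, mul_one] at hnoise
  have hgap : ∀ j, analysis q (y i) j ≤ 1 + ‖ν (τ j)‖ := fun j =>
    (real_inner_le_norm _ _).trans ((mul_le_of_le_one_right (norm_nonneg _) (h.norm_le i)).trans
      (h.norm_vertex_le j))
  have hmarkov := mul_one_sub_sum_weightAbove_le (h.weight_nonneg i) (h.weight_sum i)
    (c := 9 / 10) (by norm_num) (fun j => norm_nonneg (ν (τ j))) hgap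
  rw [Finset.sum_sub_distrib]
  simp only [nearWeight, defect, Pi.add_apply, mulVec, dotProduct, analysis] at *
  linarith [h.weight_sum i]

theorem sum_mul_nearWeight_le (h : IsNoisyFrame q y ν w u τ) (j : κ) :
    ∑ i, u i * nearWeight q y w i j ≤ 1.1123 ^ 2 := by
  have hterm : ∀ i, (9 / 10) ^ 2 * nearWeight q y w i j ≤ analysis y (q j) i ^ 2 := by
    intro i
    by_cases hi : nearWeight q y w i j = 0
    · rw [hi, mul_zero]
      positivity
    · have hnear : 9 / 10 ≤ analysis y (q j) i :=
        (le_inner_of_nearWeight_ne_zero hi).trans_eq (real_inner_comm _ _)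
      have := (h.nearWeight_le i j).trans (h.weight_le_one i j)
      nlinarith
  have hsum : (9 / 10) ^ 2 * ∑ i, u i * nearWeight q y w i j ≤ ‖q j‖ ^ 2 := by
    rw [← h.frame, Finset.mul_sum]
    refine Finset.sum_le_sum fun i _ => ?_
    rw [mul_left_comm]
    exact mul_le_mul_of_nonneg_left (hterm i) (h.nonneg i)
  nlinarith [h.norm_vertex_le_const j, norm_nonneg (q j)]

theorem wnorm_farWeight_le (h : IsNoisyFrame q y ν w u τ) (z : κ → ℝ) :
    wnorm u ((w - nearWeight q y w) *ᵥ z) ≤ 10 * wnorm u (defect ν w τ) * √(∑ j, z j ^ 2) := by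
  rw [mul_right_comm, ← wnorm_smul (by positivity)]
  refine wnorm_le_wnorm_of_abs_le h.nonneg fun i hi => ?_
  have hfar : ∀ j, 0 ≤ w i j - nearWeight q y w i j := fun j => sub_nonneg.2 (h.nearWeight_le i j)
  calc |((w - nearWeight q y w) *ᵥ z) i|
      ≤ ∑ j, |(w i j - nearWeight q y w i j) * z j| := Finset.abs_sum_le_sum_abs _ _
    _ ≤ ∑ j, (w i j - nearWeight q y w i j) * √(∑ j, z j ^ 2) :=
        Finset.sum_le_sum fun j _ => by
          rw [abs_mul, abs_of_nonneg (hfar j)]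
          exact mul_le_mul_of_nonneg_left (abs_le_sqrt_sum_sq z j) (hfar j)
    _ ≤ 10 * defect ν w τ i * √(∑ j, z j ^ 2) := by
        rw [← Finset.sum_mul]
        exact mul_le_mul_of_nonneg_right (h.sum_farWeight_le hi) (Real.sqrt_nonneg _)
    _ = ((10 * √(∑ j, z j ^ 2)) • defect ν w τ) i := by
        rw [Pi.smul_apply, smul_eq_mul, mul_right_comm]

theorem wnorm_nearWeight_le (h : IsNoisyFrame q y ν w u τ) (z : κ → ℝ) :
    wnorm u (nearWeight q y w *ᵥ z) ≤ 1.1123 * √(∑ j, z j ^ 2) := by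
  refine wnorm_le_of_sum_le h.nonneg (by positivity) ?_
  rw [mul_pow, Real.sq_sqrt (Finset.sum_nonneg fun j _ => sq_nonneg _), Finset.mul_sum]
  calc ∑ i, u i * (nearWeight q y w *ᵥ z) i ^ 2
      ≤ ∑ i, u i * ∑ j, nearWeight q y w i j * z j ^ 2 :=
        Finset.sum_le_sum fun i _ => mul_le_mul_of_nonneg_left
          (sq_sum_mul_le_sum_mul_sq (h.nearWeight_nonneg i)
            ((Finset.sum_le_sum fun j _ => h.nearWeight_le i j).trans (h.weight_sum i)) z)
          (h.nonneg i)
    _ = ∑ j, (∑ i, u i * nearWeight q y w i j) * z j ^ 2 := by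
        simp only [Finset.mul_sum, Finset.sum_mul, mul_assoc]
        exact Finset.sum_comm
    _ ≤ ∑ j, 1.1123 ^ 2 * z j ^ 2 := Finset.sum_le_sum fun j _ =>
        mul_le_mul_of_nonneg_right (h.sum_mul_nearWeight_le j) (sq_nonneg _)

theorem wnorm_mulVec_le (h : IsNoisyFrame q y ν w u τ) (z : κ → ℝ) :
    wnorm u (w *ᵥ z) ≤ (1.1123 + 10 * wnorm u (defect ν w τ)) * √(∑ j, z j ^ 2) := by
  rw [add_mul, ← add_sub_cancel (nearWeight q y w) w, add_mulVec, add_sub_cancel]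
  exact wnorm_add_le.trans (add_le_add (h.wnorm_nearWeight_le z) (h.wnorm_farWeight_le z))

theorem wnorm_norm_noise_le (h : IsNoisyFrame q y ν w u τ) :
    wnorm u (fun i => ‖ν i‖) ≤ 1 / 1000 :=
  wnorm_le_of_sum_le h.nonneg (by norm_num) <| (Finset.sum_le_sum fun i _ =>
    mul_le_of_le_one_left (sq_nonneg _) (h.frameWeight_le_one i)).trans h.noise

theorem sqrt_sum_sq_vertex_noise_le (h : IsNoisyFrame q y ν w u τ) :
    √(∑ j, ‖ν (τ j)‖ ^ 2) ≤ 1 / 1000 := by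
  classical
  refine Real.sqrt_le_iff.2 ⟨by norm_num, le_trans ?_ h.noise⟩
  rw [← Finset.sum_image (f := fun i => ‖ν i‖ ^ 2) h.injective.injOn]
  exact Finset.sum_le_sum_of_subset_of_nonneg (Finset.subset_univ _) fun _ _ _ => sq_nonneg _

/-- `wnorm_mulVec_le`, applied to the noise of the vertices, bounds the defect in terms of itself
with a factor that is small enough to be absorbed. -/
theorem wnorm_defect_le (h : IsNoisyFrame q y ν w u τ) : wnorm u (defect ν w τ) ≤ 2.2 / 1000 := by
  have hsplit : wnorm u (defect ν w τ) ≤ _ := wnorm_add_le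
  have hinherited := h.wnorm_mulVec_le fun j => ‖ν (τ j)‖
  have hdefect : 0 ≤ wnorm u (defect ν w τ) := wnorm_nonneg
  nlinarith [h.wnorm_norm_noise_le, h.sqrt_sum_sq_vertex_noise_le,
    Real.sqrt_nonneg (∑ j, ‖ν (τ j)‖ ^ 2)]

theorem wnorm_analysis_noise_le (h : IsNoisyFrame q y ν w u τ) (v : V) :
    wnorm u (analysis ν v) ≤ 1 / 1000 * ‖v‖ := by
  calc wnorm u (analysis ν v) ≤ wnorm u (‖v‖ • fun i => ‖ν i‖) :=
        wnorm_le_wnorm_of_abs_le h.nonneg fun i _ => by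
          rw [Pi.smul_apply, smul_eq_mul, mul_comm]
          exact abs_real_inner_le_norm (ν i) v
    _ = ‖v‖ * wnorm u fun i => ‖ν i‖ := wnorm_smul (norm_nonneg v)
    _ ≤ 1 / 1000 * ‖v‖ := by
        rw [mul_comm]
        exact mul_le_mul_of_nonneg_right h.wnorm_norm_noise_le (norm_nonneg v)

theorem le_wnorm_mulVec_analysis (h : IsNoisyFrame q y ν w u τ) (v : V) :
    999 / 1000 * ‖v‖ ≤ wnorm u (w *ᵥ analysis q v) := by
  have htri := wnorm_add_le (u := u) (a := w *ᵥ analysis q v) (b := analysis ν v)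
  rw [← h.analysis_eq, h.wnorm_analysis] at htri
  linarith [h.wnorm_analysis_noise_le v]

theorem wnorm_mulVec_analysis_le (h : IsNoisyFrame q y ν w u τ) (v : V) :
    wnorm u (w *ᵥ analysis q v) ≤ 1001 / 1000 * ‖v‖ := by
  have htri := wnorm_sub_le (u := u) (a := analysis y v) (b := analysis ν v)
  rw [h.wnorm_analysis, h.analysis_eq, add_sub_cancel_right] at htri
  linarith [h.wnorm_analysis_noise_le v]

theorem le_analysis (h : IsNoisyFrame q y ν w u τ) (v : V) :
    22 / 25 * ‖v‖ ≤ √(∑ j, analysis q v j ^ 2) := by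
  have hupper := h.wnorm_mulVec_le (analysis q v)
  have hdefect := mul_le_mul_of_nonneg_right h.wnorm_defect_le
    (Real.sqrt_nonneg (∑ j, analysis q v j ^ 2))
  linarith [h.le_wnorm_mulVec_analysis v, norm_nonneg v]

theorem sum_mul_sq_farWeight_le (h : IsNoisyFrame q y ν w u τ) (j : κ) :
    ∑ i, u i * (w i j - nearWeight q y w i j) ^ 2 ≤ 0.0005 := by
  have hfar : ∀ i k, 0 ≤ w i k - nearWeight q y w i k := fun i k =>
    sub_nonneg.2 (h.nearWeight_le i k)
  rw [← sq_wnorm h.nonneg]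
  calc wnorm u (fun i => w i j - nearWeight q y w i j) ^ 2
      ≤ wnorm u ((10 : ℝ) • defect ν w τ) ^ 2 :=
        pow_le_pow_left₀ wnorm_nonneg (wnorm_le_wnorm_of_abs_le h.nonneg fun i hi => by
          rw [abs_of_nonneg (hfar i j)]
          exact (Finset.single_le_sum (fun k _ => hfar i k) (Finset.mem_univ j)).trans
            (h.sum_farWeight_le hi)) 2
    _ = (10 * wnorm u (defect ν w τ)) ^ 2 := by rw [wnorm_smul (by norm_num)]
    _ ≤ (10 * (2.2 / 1000)) ^ 2 :=
        pow_le_pow_left₀ (mul_nonneg (by norm_num) wnorm_nonneg)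
          (mul_le_mul_of_nonneg_left h.wnorm_defect_le (by norm_num)) 2
    _ ≤ 0.0005 := by norm_num

variable [FiniteDimensional ℝ V]

theorem le_norm_synthesis (h : IsNoisyFrame q y ν w u τ)
    (hV : Module.finrank ℝ V = Fintype.card κ) (z : κ → ℝ) :
    22 / 25 * √(∑ j, z j ^ 2) ≤ ‖∑ j, z j • q j‖ :=
  le_norm_sum_smul_of_le_analysis hV (by norm_num) h.le_analysis z

theorem eq_of_nearWeight_ne_zero (h : IsNoisyFrame q y ν w u τ)
    (hV : Module.finrank ℝ V = Fintype.card κ) {i : ι} (hi : u i ≠ 0) {j k : κ}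
    (hj : nearWeight q y w i j ≠ 0) (hk : nearWeight q y w i k ≠ 0) : j = k := by
  classical
  by_contra hjk
  have hfar := two_mul_sq_le_norm_sub_sq hjk (by norm_num) (h.le_norm_synthesis hV _)
  have hclose := norm_sub_sq_le_of_le_inner (h.active i hi) (h.norm_vertex_le_const j)
    (h.norm_vertex_le_const k) (by norm_num) (le_inner_of_nearWeight_ne_zero hj)
    (le_inner_of_nearWeight_ne_zero hk)
  norm_num at hfar hclose
  linarith

theorem le_sum_mul_sq_weight (h : IsNoisyFrame q y ν w u τ)
    (hV : Module.finrank ℝ V = Fintype.card κ) (j : κ) : 0.996 ≤ ∑ i, u i * w i j ^ 2 := by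
  classical
  obtain ⟨v, hv⟩ := exists_analysis_eq_of_le_analysis hV (by norm_num) h.le_analysis
    (Pi.single j 1)
  have hlower := h.le_wnorm_mulVec_analysis v
  rw [hv, mulVec_single_one] at hlower
  have hinner : 1 ≤ ‖q j‖ * ‖v‖ := by
    have := real_inner_le_norm (q j) v
    rwa [← analysis, hv, Pi.single_eq_same] at this
  have hnorm : 1000 / 1001 ≤ ‖v‖ := by
    nlinarith [h.norm_vertex_le_const j, norm_nonneg v]
  rw [← sq_wnorm h.nonneg]
  change _ ≤ wnorm u (w.col j) ^ 2
  norm_num at hlower ⊢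
  nlinarith

theorem le_sum_mul_sq_nearWeight (h : IsNoisyFrame q y ν w u τ)
    (hV : Module.finrank ℝ V = Fintype.card κ) (j : κ) :
    0.9955 ≤ ∑ i, u i * nearWeight q y w i j ^ 2 := by
  have hsplit : ∀ i, u i * w i j ^ 2
      = u i * nearWeight q y w i j ^ 2 + u i * (w i j - nearWeight q y w i j) ^ 2 := by
    intro i
    unfold nearWeight weightAbove
    split_ifs <;> ring
  have htotal := h.le_sum_mul_sq_weight hV j
  simp only [hsplit, Finset.sum_add_distrib] at htotal
  have := h.sum_mul_sq_farWeight_le j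
  norm_num at *
  linarith

theorem le_wnorm_nearWeight (h : IsNoisyFrame q y ν w u τ)
    (hV : Module.finrank ℝ V = Fintype.card κ) (z : κ → ℝ) :
    0.997 * √(∑ j, z j ^ 2) ≤ wnorm u (nearWeight q y w *ᵥ z) := by
  refine le_wnorm_of_le_sum h.nonneg ?_
  rw [mul_pow, Real.sq_sqrt (Finset.sum_nonneg fun j _ => sq_nonneg _), Finset.mul_sum]
  calc ∑ j, 0.997 ^ 2 * z j ^ 2 ≤ ∑ j, (∑ i, u i * nearWeight q y w i j ^ 2) * z j ^ 2 :=
        Finset.sum_le_sum fun j _ => mul_le_mul_of_nonneg_right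
          (le_trans (by norm_num) (h.le_sum_mul_sq_nearWeight hV j)) (sq_nonneg _)
    _ = ∑ i, u i * ∑ j, (nearWeight q y w i j * z j) ^ 2 := by
        simp only [Finset.mul_sum, Finset.sum_mul, mul_pow, mul_assoc]
        exact Finset.sum_comm
    _ = ∑ i, u i * (nearWeight q y w *ᵥ z) i ^ 2 := by
        refine Finset.sum_congr rfl fun i _ => ?_
        rcases eq_or_ne (u i) 0 with hi | hi
        · simp [hi]
        · rw [mulVec, dotProduct, sq_sum_eq_sum_sq_of_subsingleton fun j k hj hk =>
            h.eq_of_nearWeight_ne_zero hV hi (left_ne_zero_of_mul hj) (left_ne_zero_of_mul hk)]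

theorem analysis_le (h : IsNoisyFrame q y ν w u τ) (hV : Module.finrank ℝ V = Fintype.card κ)
    (v : V) : √(∑ j, analysis q v j ^ 2) ≤ 11 / 10 * ‖v‖ := by
  have htri := wnorm_sub_le (u := u) (a := w *ᵥ analysis q v)
    (b := (w - nearWeight q y w) *ᵥ analysis q v)
  rw [← sub_mulVec, sub_sub_cancel] at htri
  have hdefect := mul_le_mul_of_nonneg_right h.wnorm_defect_le
    (Real.sqrt_nonneg (∑ j, analysis q v j ^ 2))
  linarith [h.le_wnorm_nearWeight hV (analysis q v), h.wnorm_mulVec_analysis_le v,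
    h.wnorm_farWeight_le (analysis q v), norm_nonneg v]

theorem norm_synthesis_le (h : IsNoisyFrame q y ν w u τ)
    (hV : Module.finrank ℝ V = Fintype.card κ) (z : κ → ℝ) :
    ‖∑ j, z j • q j‖ ≤ 11 / 10 * √(∑ j, z j ^ 2) :=
  norm_sum_smul_le_of_analysis_le (by norm_num) (h.analysis_le hV) z

end IsNoisyFrame

/-! ### Robustness of the selection step -/

section Perturbation

variable {κ V : Type*} [NormedAddCommGroup V] [InnerProductSpace ℝ V] {q x : κ → V}
  {a b : ℝ} {J : Finset κ}

theorem norm_sum_smul_le_sqrt_card_mul (hb : 0 ≤ b) (hx : ∀ j ∈ J, ‖x j‖ ≤ b) (c : κ → ℝ) :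
    ‖∑ j ∈ J, c j • x j‖ ≤ √J.card * b * √(∑ j ∈ J, c j ^ 2) := by
  have habs : ∑ j ∈ J, |c j| ≤ √J.card * √(∑ j ∈ J, c j ^ 2) := by
    rw [← Real.sqrt_mul (Nat.cast_nonneg _)]
    refine Real.le_sqrt_of_sq_le ?_
    simpa only [sq_abs] using sq_sum_le_card_mul_sum_sq (s := J) (f := fun j => |c j|)
  calc ‖∑ j ∈ J, c j • x j‖ ≤ ∑ j ∈ J, |c j| * b := norm_sum_le_of_le _ fun j hj => by
        rw [norm_smul, Real.norm_eq_abs]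
        exact mul_le_mul_of_nonneg_left (hx j hj) (abs_nonneg _)
    _ = (∑ j ∈ J, |c j|) * b := (Finset.sum_mul _ _ _).symm
    _ ≤ √J.card * √(∑ j ∈ J, c j ^ 2) * b := mul_le_mul_of_nonneg_right habs hb
    _ = √J.card * b * √(∑ j ∈ J, c j ^ 2) := mul_right_comm _ _ _

theorem norm_starProjection_orthogonal_le_of_mem [FiniteDimensional ℝ V]
    (hx : ∀ j ∈ J, ‖x j - q j‖ ≤ b) {j : κ} (hj : j ∈ J) :
    ‖(Submodule.span ℝ (x '' J))ᗮ.starProjection (q j)‖ ≤ b := by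
  have hproj : (Submodule.span ℝ (x '' J))ᗮ.starProjection (x j) = 0 :=
    Submodule.starProjection_orthogonal_apply_eq_zero
      (Submodule.subset_span (Set.mem_image_of_mem x hj))
  rw [← norm_neg, ← zero_sub, ← hproj, ← map_sub]
  exact (Submodule.norm_starProjection_apply_le _ _).trans (hx j hj)

variable [Fintype κ]

theorem le_norm_sum_smul_sub_sum_smul (hq : ∀ z : κ → ℝ, a * √(∑ j, z j ^ 2) ≤ ‖∑ j, z j • q j‖)
    (hb : 0 ≤ b) (hba : √(Fintype.card κ) * b ≤ a) (hx : ∀ j ∈ J, ‖x j - q j‖ ≤ b) {z : κ → ℝ}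
    (hz : ∀ j ∈ J, z j = 0) (c : κ → ℝ) :
    (a - √(Fintype.card κ) * b) * √(∑ j, z j ^ 2) ≤
      ‖∑ j, z j • q j - ∑ j ∈ J, c j • x j‖ := by
  classical
  set c₀ : κ → ℝ := fun j => if j ∈ J then c j else 0 with hc₀
  have hsplit : ∑ j, z j • q j - ∑ j ∈ J, c j • x j
      = ∑ j, (z j - c₀ j) • q j - ∑ j ∈ J, c j • (x j - q j) := by
    simp only [hc₀, sub_smul, smul_sub, Finset.sum_sub_distrib, ite_smul, zero_smul,
      Finset.sum_ite_mem, Finset.univ_inter]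
    abel
  have hsq : ∑ j, (z j - c₀ j) ^ 2 = ∑ j, z j ^ 2 + ∑ j ∈ J, c j ^ 2 := by
    rw [← Finset.univ_inter J, ← Finset.sum_ite_mem, ← Finset.sum_add_distrib]
    refine Finset.sum_congr rfl fun j _ => ?_
    by_cases hj : j ∈ J <;> simp [hc₀, hj, hz]
  set s := √(∑ j, (z j - c₀ j) ^ 2)
  have hzs : √(∑ j, z j ^ 2) ≤ s :=
    Real.sqrt_le_sqrt (hsq ▸ le_add_of_nonneg_right (Finset.sum_nonneg fun _ _ => sq_nonneg _))
  have hcs : √(∑ j ∈ J, c j ^ 2) ≤ s :=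
    Real.sqrt_le_sqrt (hsq ▸ le_add_of_nonneg_left (Finset.sum_nonneg fun _ _ => sq_nonneg _))
  have herr : ‖∑ j ∈ J, c j • (x j - q j)‖ ≤ √(Fintype.card κ) * b * s := by
    refine (norm_sum_smul_le_sqrt_card_mul hb hx c).trans ?_
    gcongr
    exact J.card_le_univ
  calc (a - √(Fintype.card κ) * b) * √(∑ j, z j ^ 2) ≤ (a - √(Fintype.card κ) * b) * s :=
        mul_le_mul_of_nonneg_left hzs (sub_nonneg.2 hba)
    _ ≤ ‖∑ j, (z j - c₀ j) • q j‖ - ‖∑ j ∈ J, c j • (x j - q j)‖ := by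
        rw [sub_mul]
        exact sub_le_sub (hq _) herr
    _ ≤ ‖∑ j, z j • q j - ∑ j ∈ J, c j • x j‖ := hsplit ▸ norm_sub_norm_le _ _

theorem le_norm_starProjection_orthogonal [FiniteDimensional ℝ V]
    (hq : ∀ z : κ → ℝ, a * √(∑ j, z j ^ 2) ≤ ‖∑ j, z j • q j‖) (hb : 0 ≤ b)
    (hba : √(Fintype.card κ) * b ≤ a) (hx : ∀ j ∈ J, ‖x j - q j‖ ≤ b) {z : κ → ℝ}
    (hz : ∀ j ∈ J, z j = 0) :
    (a - √(Fintype.card κ) * b) * √(∑ j, z j ^ 2) ≤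
      ‖(Submodule.span ℝ (x '' J))ᗮ.starProjection (∑ j, z j • q j)‖ := by
  obtain ⟨c, hc⟩ := (Submodule.mem_span_image_finset_iff_exists_fun' ℝ).1
    ((Submodule.span ℝ (x '' J)).starProjection_apply_mem (∑ j, z j • q j))
  rw [Submodule.starProjection_orthogonal_val, ← hc]
  exact le_norm_sum_smul_sub_sum_smul hq hb hba hx hz c

end Perturbation

/-- The points `y i` are, up to errors of size `μ`, subconvex combinations with coefficients `w` of
the well conditioned points `q j`, and the `y (τ j)` are approximations of the `q j` themselves. -/
structure IsNearSimplex {ι κ V : Type*} [Fintype κ] [NormedAddCommGroup V] [InnerProductSpace ℝ V]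
    (q : κ → V) (y : ι → V) (w : Matrix ι κ ℝ) (τ : κ → ι) (μ : ℝ) : Prop where
  weight_nonneg : ∀ i j, 0 ≤ w i j
  weight_sum : ∀ i, ∑ j, w i j ≤ 1
  noise : ∀ i, ‖y i - ∑ j, w i j • q j‖ ≤ μ
  vertex : ∀ j, ‖y (τ j) - q j‖ ≤ μ
  lower : ∀ z : κ → ℝ, 22 / 25 * √(∑ j, z j ^ 2) ≤ ‖∑ j, z j • q j‖
  upper : ∀ j, ‖q j‖ ≤ 11 / 10
  nonneg : 0 ≤ μ
  small : √(Fintype.card κ) * μ ≤ 1 / 900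

namespace IsNearSimplex

variable {ι κ V : Type*} [Fintype κ] [NormedAddCommGroup V] [InnerProductSpace ℝ V] {q : κ → V}
  {y : ι → V} {w : Matrix ι κ ℝ} {τ : κ → ι} {μ : ℝ}

theorem noise_small (h : IsNearSimplex q y w τ μ) [Nonempty κ] : μ ≤ 1 / 900 :=
  (le_mul_of_one_le_left h.nonneg (Real.one_le_sqrt.2 (Nat.one_le_cast.2 Fintype.card_pos))).trans
    h.small

variable [FiniteDimensional ℝ V] {x : κ → V} {J : Finset κ}

theorem le_norm_starProjection_sum (h : IsNearSimplex q y w τ μ)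
    (hx : ∀ j ∈ J, ‖x j - q j‖ ≤ 80 * μ) {z : κ → ℝ} (hz : ∀ j ∈ J, z j = 0) :
    79 / 100 * √(∑ j, z j ^ 2) ≤
      ‖(Submodule.span ℝ (x '' J))ᗮ.starProjection (∑ j, z j • q j)‖ := by
  have hsmall := h.small
  refine le_trans ?_ (le_norm_starProjection_orthogonal h.lower
    (mul_nonneg (by norm_num) h.nonneg) (by linarith) hx hz)
  exact mul_le_mul_of_nonneg_right (by linarith) (Real.sqrt_nonneg _)

theorem le_norm_starProjection (h : IsNearSimplex q y w τ μ)
    (hx : ∀ j ∈ J, ‖x j - q j‖ ≤ 80 * μ) {j : κ} (hj : j ∉ J) :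
    79 / 100 ≤ ‖(Submodule.span ℝ (x '' J))ᗮ.starProjection (q j)‖ := by
  classical
  simpa [Pi.single_apply] using h.le_norm_starProjection_sum hx (z := Pi.single j 1)
    fun k hk => Pi.single_eq_of_ne (ne_of_mem_of_not_mem hk hj) _

theorem le_norm_starProjection_sub (h : IsNearSimplex q y w τ μ)
    (hx : ∀ j ∈ J, ‖x j - q j‖ ≤ 80 * μ) {j k : κ} (hj : j ∉ J) (hk : k ∉ J) (hjk : j ≠ k) :
    2 * (79 / 100) ^ 2 ≤ ‖(Submodule.span ℝ (x '' J))ᗮ.starProjection (q j) -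
      (Submodule.span ℝ (x '' J))ᗮ.starProjection (q k)‖ ^ 2 := by
  classical
  refine two_mul_sq_le_norm_sub_sq
    (q := fun l => (Submodule.span ℝ (x '' J))ᗮ.starProjection (q l)) hjk (by norm_num) ?_
  simpa only [map_sum, map_smul] using h.le_norm_starProjection_sum hx
    (z := Pi.single j 1 - Pi.single k 1) fun l hl => by
      rw [Pi.sub_apply, Pi.single_eq_of_ne (ne_of_mem_of_not_mem hl hj),
        Pi.single_eq_of_ne (ne_of_mem_of_not_mem hl hk), sub_zero]

theorem exists_norm_starProjection_max (h : IsNearSimplex q y w τ μ)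
    (hx : ∀ j ∈ J, ‖x j - q j‖ ≤ 80 * μ) (hJ : J ≠ Finset.univ) :
    ∃ j₀ ∉ J, ∀ j, ‖(Submodule.span ℝ (x '' J))ᗮ.starProjection (q j)‖ ≤
      ‖(Submodule.span ℝ (x '' J))ᗮ.starProjection (q j₀)‖ := by
  classical
  obtain ⟨j₀, hj₀, hmax⟩ := Finset.exists_max_image Jᶜ
    (fun j => ‖(Submodule.span ℝ (x '' J))ᗮ.starProjection (q j)‖)
    (Finset.nonempty_iff_ne_empty.2 (J.compl_eq_empty_iff.not.2 hJ))
  rw [Finset.mem_compl] at hj₀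
  have : Nonempty κ := ⟨j₀⟩
  refine ⟨j₀, hj₀, fun j => ?_⟩
  by_cases hj : j ∈ J
  · linarith [norm_starProjection_orthogonal_le_of_mem hx hj, h.le_norm_starProjection hx hj₀,
      h.noise_small]
  · exact hmax j (Finset.mem_compl.2 hj)

theorem exists_vertex_of_norm_max (h : IsNearSimplex q y w τ μ)
    (hx : ∀ j ∈ J, ‖x j - q j‖ ≤ 80 * μ) (hJ : J ≠ Finset.univ) {i : ι}
    (hmax : ∀ k, ‖(Submodule.span ℝ (x '' J))ᗮ.starProjection (y k)‖ ≤
      ‖(Submodule.span ℝ (x '' J))ᗮ.starProjection (y i)‖) :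
    (Submodule.span ℝ (x '' J))ᗮ.starProjection (y i) ≠ 0 ∧ ∃ l ∉ J, ‖y i - q l‖ ≤ 80 * μ := by
  obtain ⟨j₀, hj₀, hle⟩ := h.exists_norm_starProjection_max hx hJ
  have : Nonempty κ := ⟨j₀⟩
  have hμ := h.noise_small
  have hm := h.le_norm_starProjection hx hj₀
  have hsub := fun j k => h.le_norm_starProjection_sub hx (j := j) (k := k)
  have hmem := fun j => norm_starProjection_orthogonal_le_of_mem hx (j := j)
  set Q := (Submodule.span ℝ (x '' J))ᗮ.starProjection
  have hQ : ∀ v, ‖Q v‖ ≤ ‖v‖ := Submodule.norm_starProjection_apply_le _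
  set m := ‖Q (q j₀)‖
  have hm' : m ≤ 11 / 10 := (hQ _).trans (h.upper j₀)
  have hyi : m - μ ≤ ‖Q (y i)‖ := by
    have hdist := (norm_le_insert' (Q (q j₀)) (Q (y (τ j₀)))).trans (add_le_add (hmax (τ j₀))
      ((norm_sub_rev _ _).trans_le (by simpa only [map_sub] using (hQ _).trans (h.vertex j₀))))
    linarith
  have hcomb : m - 2 * μ ≤ ‖∑ j, w i j • Q (q j)‖ := by
    have hdist : ‖Q (y i) - ∑ j, w i j • Q (q j)‖ ≤ μ := by
      simpa only [map_sub, map_sum, map_smul] using (hQ _).trans (h.noise i)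
    linarith [norm_le_insert' (Q (y i)) (∑ j, w i j • Q (q j))]
  refine ⟨norm_pos_iff.1 (by linarith), ?_⟩
  obtain ⟨l, hl, hwl⟩ := exists_dominant_weight (q := fun j => Q (q j)) (c := 9 / 10 * m)
    (h.weight_nonneg i) (h.weight_sum i) hle (by linarith) (by linarith) fun j k hjk hj hk => by
      have hnot : ∀ j, 9 / 10 * m ≤ ‖Q (q j)‖ → j ∉ J := fun j hj hjJ => by
        linarith [hmem j hjJ]
      nlinarith [hsub j k (hnot j hj) (hnot k hk) hjk]
  refine ⟨l, fun hlJ => by linarith [hmem l hlJ], ?_⟩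
  have hwl' : 1 - w i l ≤ 26 * μ := by nlinarith [h.nonneg]
  have hcl := norm_sum_smul_sub_le h.upper (h.weight_nonneg i) (h.weight_sum i) l
  linarith [h.nonneg, h.noise i, norm_sub_le_norm_sub_add_norm_sub (y i)
    (∑ j, w i j • q j) (q l)]

end IsNearSimplex

/-! ### Runs of SPA -/

/-- The columns of a matrix as points of Euclidean space. -/
def colPoint {n m : ℕ} (A : Matrix (Fin n) (Fin m) ℝ) (k : Fin m) : EuclideanSpace ℝ (Fin n) :=
  WithLp.toLp 2 (A.col k)

section SPA

variable {n m r : ℕ} {A : Matrix (Fin n) (Fin m) ℝ} {s s' : SPAState n m}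

theorem inner_colPoint (A : Matrix (Fin n) (Fin m) ℝ) (i k : Fin m) :
    ⟪colPoint A i, colPoint A k⟫_ℝ = A.col i ⬝ᵥ A.col k := by
  rw [colPoint, colPoint, EuclideanSpace.inner_toLp_toLp, dotProduct_comm, star_trivial]

theorem colPoint_eq_zero {k : Fin m} : colPoint A k = 0 ↔ A.col k = 0 := by
  rw [colPoint, WithLp.toLp_eq_zero]

theorem norm_colPoint_le_norm_colPoint {i k : Fin m} :
    ‖colPoint A k‖ ≤ ‖colPoint A i‖ ↔ A.col k ⬝ᵥ A.col k ≤ A.col i ⬝ᵥ A.col i := by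
  rw [← inner_colPoint, ← inner_colPoint, real_inner_self_eq_norm_sq, real_inner_self_eq_norm_sq,
    sq_le_sq₀ (norm_nonneg _) (norm_nonneg _)]

theorem colPoint_deflate (S : Matrix (Fin n) (Fin m) ℝ) (i k : Fin m) :
    colPoint ((1 - (S.col i ⬝ᵥ S.col i)⁻¹ • vecMulVec (S.col i) (S.col i)) * S) k =
      (Submodule.span ℝ {colPoint S i})ᗮ.starProjection (colPoint S k) := by
  rw [Submodule.starProjection_orthogonal_val, Submodule.starProjection_singleton,
    inner_colPoint, RCLike.ofReal_real_eq_id, id, ← real_inner_self_eq_norm_sq, inner_colPoint]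
  ext a
  simp only [colPoint, col_apply, Matrix.sub_mul, Matrix.one_mul, Matrix.smul_mul,
    Matrix.sub_apply, Matrix.smul_apply, smul_eq_mul, vecMulVec_mul, vecMulVec_apply,
    PiLp.sub_apply, PiLp.smul_apply, vecMul, dotProduct]
  ring

section Projection

variable {V : Type*} [NormedAddCommGroup V] [InnerProductSpace ℝ V] [FiniteDimensional ℝ V]

theorem sub_starProjection_orthogonal_mem (K : Submodule ℝ V) (v : V) :
    v - Kᗮ.starProjection v ∈ K := by
  rw [Submodule.starProjection_orthogonal_val, sub_sub_cancel]
  exact Submodule.starProjection_apply_mem _ _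

theorem starProjection_orthogonal_span_insert (T : Set V) (a v : V) :
    (Submodule.span ℝ (insert a T))ᗮ.starProjection v =
      (Submodule.span ℝ {(Submodule.span ℝ T)ᗮ.starProjection a})ᗮ.starProjection
        ((Submodule.span ℝ T)ᗮ.starProjection v) := by
  have hat := sub_starProjection_orthogonal_mem (Submodule.span ℝ T) a
  have hvs := sub_starProjection_orthogonal_mem (Submodule.span ℝ T) v
  set K := Submodule.span ℝ T
  set K' := Submodule.span ℝ (insert a T)
  set t := Kᗮ.starProjection a
  set s := Kᗮ.starProjection v
  have hsp := sub_starProjection_orthogonal_mem (Submodule.span ℝ {t}) s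
  set p := (Submodule.span ℝ {t})ᗮ.starProjection s
  have hKK' : K ≤ K' := Submodule.span_mono (Set.subset_insert a T)
  have ht : t ∈ Kᗮ := Submodule.starProjection_apply_mem _ _
  have htK' : t ∈ K' := by
    rw [← sub_sub_cancel a t]
    exact K'.sub_mem (Submodule.subset_span (Set.mem_insert a T)) (hKK' hat)
  have hpK : p ∈ Kᗮ := by
    rw [← sub_sub_cancel s p]
    exact Kᗮ.sub_mem (Submodule.starProjection_apply_mem _ _)
      ((Submodule.span_singleton_le_iff_mem _ _).2 ht hsp)
  have hap : ⟪a, p⟫_ℝ = 0 := by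
    have htp : ⟪t, p⟫_ℝ = 0 := Submodule.mem_orthogonal_singleton_iff_inner_right.1
      (Submodule.starProjection_apply_mem _ _)
    rw [← sub_add_cancel a t, inner_add_left, htp, hpK _ hat, add_zero]
  refine Submodule.eq_starProjection_of_mem_orthogonal ?_ (Submodule.le_orthogonal_orthogonal _ ?_)
  · rw [show K' = Submodule.span ℝ {a} ⊔ K from Submodule.span_insert _ _,
      ← Submodule.inf_orthogonal]
    exact ⟨Submodule.mem_orthogonal_singleton_iff_inner_right.2 hap, hpK⟩
  · rw [← sub_add_sub_cancel v s p]
    exact K'.add_mem (hKK' hvs) ((Submodule.span_singleton_le_iff_mem _ _).2 htK' hsp)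

end Projection

theorem SPAReaches.card_le (hs : SPAReaches A r s) : s.I.card ≤ r := by
  induction hs with
  | refl => exact Nat.zero_le r
  | tail _ hstep _ =>
    obtain ⟨hcard, i, -, -, -, hI⟩ := hstep
    rw [hI]
    exact (Finset.card_insert_le _ _).trans hcard

variable {κ : Type*} {q : κ → EuclideanSpace ℝ (Fin n)} {w : Matrix (Fin m) κ ℝ} {τ : κ → Fin m}
  {μ : ℝ} {J : Finset κ} {g : κ → Fin m}

/-- In the state `s` of a run of SPA on `A`, the columns found so far are the `g j` with `j ∈ J`;
each of them is an approximation of the vertex `q j`, and the current columns are the projections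
of those of `A` onto the orthogonal complement of the columns found so far. The values of `g`
outside `J` are irrelevant. -/
structure SPAInvariant (A : Matrix (Fin n) (Fin m) ℝ) (q : κ → EuclideanSpace ℝ (Fin n)) (μ : ℝ)
    (s : SPAState n m) (J : Finset κ) (g : κ → Fin m) : Prop where
  image : J.image g = s.I
  card : s.I.card = J.card
  close : ∀ j ∈ J, ‖colPoint A (g j) - q j‖ ≤ 80 * μ
  proj : ∀ k, colPoint s.S k =
    (Submodule.span ℝ ((fun j => colPoint A (g j)) '' J))ᗮ.starProjection (colPoint A k)

theorem SPAInvariant.initial : SPAInvariant A q μ ⟨A, ∅⟩ ∅ g where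
  image := Finset.image_empty g
  card := rfl
  close := by simp
  proj k := by
    rw [Finset.coe_empty, Set.image_empty, Submodule.span_empty,
      Submodule.starProjection_orthogonal_val, Submodule.starProjection_bot, _root_.zero_apply,
      sub_zero]

variable [Fintype κ]

theorem SPAInvariant.ne_univ (h : SPAInvariant A q μ s J g) (hcard : s.I.card < Fintype.card κ) :
    J ≠ Finset.univ := by
  rintro rfl
  exact (h.card ▸ hcard).ne Finset.card_univ

theorem SPAInvariant.exists_vertex (h : SPAInvariant A q μ s J g)
    (hA : IsNearSimplex q (colPoint A) w τ μ) (hcard : s.I.card < Fintype.card κ) {i : Fin m}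
    (hi : ∀ k, s.S.col k ⬝ᵥ s.S.col k ≤ s.S.col i ⬝ᵥ s.S.col i) :
    colPoint s.S i ≠ 0 ∧ ∃ l ∉ J, ‖colPoint A i - q l‖ ≤ 80 * μ := by
  rw [h.proj]
  refine hA.exists_vertex_of_norm_max h.close (h.ne_univ hcard) fun k => ?_
  rw [← h.proj, ← h.proj, norm_colPoint_le_norm_colPoint]
  exact hi k

theorem SPAInvariant.step (h : SPAInvariant A q μ s J g)
    (hA : IsNearSimplex q (colPoint A) w τ μ) (hs : SPAStep (Fintype.card κ) s s') :
    s'.I.card = s.I.card + 1 ∧ ∃ J' g', SPAInvariant A q μ s' J' g' := by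
  classical
  obtain ⟨hcard, i, hmax, hne, hS, hI⟩ := hs
  obtain ⟨-, l, hl, hil⟩ := h.exists_vertex hA hcard hmax
  have hi : i ∉ s.I := by
    rw [← h.image, Finset.mem_image]
    rintro ⟨j, hj, rfl⟩
    refine hne (colPoint_eq_zero.1 ?_)
    rw [h.proj]
    exact Submodule.starProjection_orthogonal_apply_eq_zero
      (Submodule.subset_span (Set.mem_image_of_mem _ hj))
  have hcard' : s'.I.card = s.I.card + 1 := by rw [hI, Finset.card_insert_of_notMem hi]
  have hupdate : ∀ j ∈ J, Function.update g l i j = g j := fun j hj =>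
    Function.update_of_ne (ne_of_mem_of_not_mem hj hl) _ _
  refine ⟨hcard', insert l J, Function.update g l i, ?_, ?_, ?_, fun k => ?_⟩
  · rw [Finset.image_insert, Function.update_self, Finset.image_congr hupdate, h.image, hI]
  · rw [hcard', h.card, Finset.card_insert_of_notMem hl]
  · rw [Finset.forall_mem_insert, Function.update_self]
    exact ⟨hil, fun j hj => (hupdate j hj).symm ▸ h.close j hj⟩
  · rw [hS, colPoint_deflate, h.proj i, h.proj k, ← starProjection_orthogonal_span_insert,
      Finset.coe_insert, Set.image_insert_eq, Function.update_self,
      Set.image_congr fun j hj => congrArg (colPoint A) (hupdate j hj)]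

theorem SPAReaches.invariant (hs : SPAReaches A (Fintype.card κ) s)
    (hA : IsNearSimplex q (colPoint A) w τ μ) : ∃ J g, SPAInvariant A q μ s J g := by
  induction hs with
  | refl => exact ⟨∅, τ, .initial⟩
  | tail _ hstep ih =>
    obtain ⟨J, g, h⟩ := ih
    exact (h.step hA hstep).2

theorem SPAReaches.card_step (hs : SPAReaches A (Fintype.card κ) s)
    (hA : IsNearSimplex q (colPoint A) w τ μ) (hstep : SPAStep (Fintype.card κ) s s') :
    s'.I.card = s.I.card + 1 :=
  let ⟨_, _, h⟩ := hs.invariant hA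
  (h.step hA hstep).1

theorem not_exists_infinite_run (hA : IsNearSimplex q (colPoint A) w τ μ) :
    ¬ ∃ run : ℕ → SPAState n m,
      run 0 = ⟨A, ∅⟩ ∧ ∀ k, SPAStep (Fintype.card κ) (run k) (run (k + 1)) := by
  rintro ⟨run, h0, hrun⟩
  have hreach : ∀ k, SPAReaches A (Fintype.card κ) (run k) := fun k => by
    induction k with
    | zero => exact h0 ▸ Relation.ReflTransGen.refl
    | succ k ih => exact ih.tail (hrun k)
  have hcard : ∀ k, (run k).I.card = k := fun k => by
    induction k with
    | zero => simp [h0]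
    | succ k ih => rw [(hreach k).card_step hA (hrun k), ih]
  exact (hcard (Fintype.card κ + 1) ▸ (hreach _).card_le).not_gt (Nat.lt_succ_self _)

theorem SPAReaches.exists_step (hs : SPAReaches A (Fintype.card κ) s)
    (hA : IsNearSimplex q (colPoint A) w τ μ) (hcard : s.I.card < Fintype.card κ) :
    ∃ s', SPAStep (Fintype.card κ) s s' := by
  obtain ⟨J, g, h⟩ := hs.invariant hA
  obtain ⟨j₀⟩ := Fintype.card_pos_iff.1 (Nat.zero_lt_of_lt hcard)
  have : Nonempty (Fin m) := ⟨τ j₀⟩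
  obtain ⟨i, hi⟩ := Finite.exists_max fun k => s.S.col k ⬝ᵥ s.S.col k
  exact ⟨⟨_, _⟩, hcard, i, hi, mt colPoint_eq_zero.2 (h.exists_vertex hA hcard hi).1, rfl, rfl⟩

theorem IsNearSimplex.spaTerminates (hA : IsNearSimplex q (colPoint A) w τ μ) :
    SPATerminates A (Fintype.card κ) :=
  ⟨not_exists_infinite_run hA, fun _ hs => hs.exists_step hA⟩

theorem IsNearSimplex.exists_equiv_of_spaReturns (hA : IsNearSimplex q (colPoint A) w τ μ)
    {I : Finset (Fin m)} (hI : SPAReturns A (Fintype.card κ) I) :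
    ∃ order : κ ≃ I, ∀ j, ‖colPoint A (order j) - q j‖ ≤ 80 * μ := by
  obtain ⟨S, hS, hcard⟩ := hI
  obtain ⟨J, g, h⟩ := hS.invariant hA
  obtain rfl : J = Finset.univ := Finset.eq_univ_of_card J
    (h.card.symm.trans (le_antisymm hS.card_le hcard))
  have himage : Finset.univ.image g = I := h.image
  have hgI : ∀ j, g j ∈ I := fun j => himage ▸ Finset.mem_image_of_mem g (Finset.mem_univ j)
  have hsurj : Function.Surjective fun j => (⟨g j, hgI j⟩ : I) := fun ⟨i, hi⟩ => by
    obtain ⟨j, -, rfl⟩ := Finset.mem_image.1 (himage.symm ▸ hi)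
    exact ⟨j, rfl⟩
  refine ⟨Equiv.ofBijective _ ((Fintype.bijective_iff_surjective_and_card _).2 ⟨hsurj, ?_⟩),
    fun j => h.close j (Finset.mem_univ j)⟩
  rw [Fintype.card_coe, h.card, Finset.card_univ]

end SPA

/-! ### Minimum volume enclosing ellipsoids -/

section OptimalityConditions

open Filter Topology

variable {n : Type*} [Fintype n]

theorem exists_abs_dotProduct_mulVec_le (G : Matrix n n ℝ) :
    ∃ C, ∀ x : n → ℝ, |x ⬝ᵥ G *ᵥ x| ≤ C * (x ⬝ᵥ x) := by
  classical
  refine ⟨‖toEuclideanCLM (𝕜 := ℝ) G‖, fun x => ?_⟩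
  set v : EuclideanSpace ℝ n := WithLp.toLp 2 x
  have hv : x ⬝ᵥ x = ‖v‖ * ‖v‖ := by
    rw [← real_inner_self_eq_norm_mul_norm, EuclideanSpace.inner_eq_star_dotProduct, star_trivial]
  rw [hv, show x ⬝ᵥ G *ᵥ x = ⟪v, toEuclideanCLM (𝕜 := ℝ) G v⟫_ℝ from
    (inner_toEuclideanCLM G v v).symm, ← mul_assoc, mul_comm]
  exact (abs_real_inner_le_norm _ _).trans
    (mul_le_mul_of_nonneg_left (ContinuousLinearMap.le_opNorm _ _) (norm_nonneg _))

theorem exists_eq_trace_mul (f : Matrix n n ℝ →ₗ[ℝ] ℝ) :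
    ∃ H : Matrix n n ℝ, ∀ X, f X = (H * X).trace := by
  classical
  refine ⟨of fun j k => f (single k j 1), fun X => ?_⟩
  have hlin : f = traceLinearMap n ℝ ℝ ∘ₗ
      LinearMap.mulLeft ℝ (of fun j k => f (single k j 1)) :=
    ext_linearMap ℝ fun i j => LinearMap.ext_ring (by simp [trace_mul_single])
  exact congrArg (· X) hlin

variable [DecidableEq n]

theorem dotProduct_one_add_smul_mulVec (G : Matrix n n ℝ) (t : ℝ) (x : n → ℝ) :
    x ⬝ᵥ (1 + t • G) *ᵥ x = x ⬝ᵥ x + t * (x ⬝ᵥ G *ᵥ x) := by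
  rw [add_mulVec, one_mulVec, dotProduct_add, smul_mulVec, dotProduct_smul, smul_eq_mul]

theorem tendsto_add_mul_nhdsGT_zero {f : ℝ → ℝ} (hf : Continuous f) (a : ℝ) :
    Tendsto (fun t => a + t * f t) (𝓝[>] 0) (𝓝 a) := by
  have hcont : Continuous fun t => a + t * f t := by fun_prop
  simpa using (hcont.tendsto 0).mono_left nhdsWithin_le_nhds

theorem eventually_posDef_one_add_smul {n : Type*} [Finite n] [DecidableEq n] {G : Matrix n n ℝ}
    (hG : G.IsHermitian) : ∀ᶠ t : ℝ in 𝓝[>] 0, (1 + t • G).PosDef := by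
  have := Fintype.ofFinite n
  obtain ⟨C, hC⟩ := exists_abs_dotProduct_mulVec_le G
  filter_upwards [(tendsto_add_mul_nhdsGT_zero (f := fun _ => C) continuous_const 0).eventually
    (gt_mem_nhds one_pos), self_mem_nhdsWithin] with t htC (ht : 0 < t)
  refine PosDef.of_dotProduct_mulVec_pos ?_ fun x hx => ?_
  · exact isHermitian_one.add (hG.smul (.all t))
  · have hxx : 0 < x ⬝ᵥ x := by simpa using dotProduct_star_self_pos_iff.2 hx
    rw [star_trivial, dotProduct_one_add_smul_mulVec]
    nlinarith [neg_le_of_abs_le (hC x)]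

theorem eventually_one_lt_det_one_add_smul {G : Matrix n n ℝ} (hG : 0 < G.trace) :
    ∀ᶠ t : ℝ in 𝓝[>] 0, 1 < (1 + t • G).det := by
  set p := (det (1 + (Polynomial.X : Polynomial ℝ) • G.map Polynomial.C)).divX.divX
  filter_upwards [(tendsto_add_mul_nhdsGT_zero p.continuous G.trace).eventually
    (lt_mem_nhds hG), self_mem_nhdsWithin] with t hpos (ht : 0 < t)
  rw [det_one_add_smul]
  nlinarith [mul_pos ht hpos]

theorem eventually_dotProduct_one_add_smul_mulVec_le_one {G : Matrix n n ℝ} {x : n → ℝ}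
    (hx : x ⬝ᵥ x ≤ 1) (hG : x ⬝ᵥ x = 1 → x ⬝ᵥ G *ᵥ x < 0) :
    ∀ᶠ t : ℝ in 𝓝[>] 0, x ⬝ᵥ (1 + t • G) *ᵥ x ≤ 1 := by
  simp only [dotProduct_one_add_smul_mulVec]
  rcases hx.lt_or_eq with hlt | heq
  · exact ((tendsto_add_mul_nhdsGT_zero continuous_const _).eventually (gt_mem_nhds hlt)).mono
      fun _ => le_of_lt
  · filter_upwards [self_mem_nhdsWithin] with t (ht : 0 < t)
    linarith [mul_neg_of_pos_of_neg ht (hG heq)]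

/-- The functional that separates `1 / card n` from the hull becomes `G` after symmetrization and
subtraction of a multiple of the identity. -/
theorem exists_isHermitian_of_notMem_convexHull [Nonempty n] {s : Set (n → ℝ)} (hs : s.Finite)
    (hunit : ∀ x ∈ s, x ⬝ᵥ x = 1)
    (h : (Fintype.card n : ℝ)⁻¹ • (1 : Matrix n n ℝ) ∉
      convexHull ℝ ((fun x => vecMulVec x x) '' s)) :
    ∃ G : Matrix n n ℝ, G.IsHermitian ∧ 0 < G.trace ∧ ∀ x ∈ s, x ⬝ᵥ G *ᵥ x < 0 := by
  have : LocallyConvexSpace ℝ (Matrix n n ℝ) :=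
    inferInstanceAs (LocallyConvexSpace ℝ (n → n → ℝ))
  obtain ⟨f, c, hfs, hf1⟩ := geometric_hahn_banach_closed_point (convex_convexHull ℝ _)
    ((hs.image fun x => vecMulVec x x).isClosed_convexHull ℝ) h
  obtain ⟨H, hH⟩ := exists_eq_trace_mul f.toLinearMap
  simp only [ContinuousLinearMap.coe_coe] at hH
  refine ⟨(1 / 2 : ℝ) • (H + Hᵀ) - c • 1, ?_, ?_, fun x hx => ?_⟩
  · rw [isHermitian_iff_isSymm, IsSymm, transpose_sub, transpose_smul, transpose_add,
      transpose_transpose, transpose_smul, transpose_one, add_comm]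
  · rw [hH, Matrix.mul_smul, Matrix.mul_one, trace_smul, smul_eq_mul, inv_mul_eq_div,
      lt_div_iff₀ (by positivity)] at hf1
    rw [trace_sub, trace_smul, trace_smul, trace_add, trace_transpose, trace_one, smul_eq_mul,
      smul_eq_mul]
    linarith
  · have hneg := hfs _ (subset_convexHull ℝ _ ⟨x, hx, rfl⟩)
    rw [hH, mul_vecMulVec, trace_vecMulVec, dotProduct_comm] at hneg
    rw [sub_mulVec, smul_mulVec, smul_mulVec, add_mulVec, one_mulVec, dotProduct_sub,
      dotProduct_smul, dotProduct_smul, dotProduct_add, dotProduct_transpose_mulVec, smul_eq_mul,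
      smul_eq_mul, hunit x hx]
    linarith

theorem exists_weights_of_mem_convexHull_image {ι E : Type*} [Fintype ι] [AddCommGroup E]
    [Module ℝ E] {y : ι → E} {s : Set ι} {x : E} (hx : x ∈ convexHull ℝ (y '' s)) :
    ∃ c : ι → ℝ, (∀ i, 0 ≤ c i) ∧ (∀ i, c i ≠ 0 → i ∈ s) ∧ ∑ i, c i • y i = x := by
  classical
  obtain ⟨σ, _, c, z, hc, -, hz, rfl⟩ := mem_convexHull_iff_exists_fintype.1 hx
  choose idx hidx hz using hz
  refine ⟨fun i => ∑ k with idx k = i, c k, fun i => Finset.sum_nonneg fun k _ => hc k,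
    fun i hi => ?_, ?_⟩
  · obtain ⟨k, hk, -⟩ := Finset.exists_ne_zero_of_sum_ne_zero hi
    exact (Finset.mem_filter.1 hk).2 ▸ hidx k
  · rw [← Finset.sum_fiberwise Finset.univ idx fun k => c k • z k]
    refine Finset.sum_congr rfl fun i _ => ?_
    rw [Finset.sum_smul]
    refine Finset.sum_congr rfl fun k hk => ?_
    rw [← hz k, (Finset.mem_filter.1 hk).2]

/-- John's theorem: if the unit ball is optimal, the contact points carry weights that make them a
tight frame; otherwise `1 + t • G` would be a better ellipsoid for small `t`. -/
theorem exists_weights_of_det_le_one [Nonempty n] {ι : Type*} [Fintype ι] (y : ι → n → ℝ)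
    (hy : ∀ i, y i ⬝ᵥ y i ≤ 1)
    (hopt : ∀ M : Matrix n n ℝ, M.PosDef → (∀ i, y i ⬝ᵥ M *ᵥ y i ≤ 1) → M.det ≤ 1) :
    ∃ u : ι → ℝ, (∀ i, 0 ≤ u i) ∧ (∀ i, u i ≠ 0 → y i ⬝ᵥ y i = 1) ∧
      ∑ i, u i • vecMulVec (y i) (y i) = 1 := by
  set s : Set ι := {i | y i ⬝ᵥ y i = 1}
  have hmem : (Fintype.card n : ℝ)⁻¹ • (1 : Matrix n n ℝ) ∈
      convexHull ℝ ((fun x => vecMulVec x x) '' (y '' s)) := by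
    by_contra hnot
    obtain ⟨G, hG, htrace, hneg⟩ := exists_isHermitian_of_notMem_convexHull
      (s.toFinite.image y) (by rintro _ ⟨i, hi, rfl⟩; exact hi) hnot
    have hfeas : ∀ᶠ t : ℝ in 𝓝[>] 0, ∀ i, y i ⬝ᵥ (1 + t • G) *ᵥ y i ≤ 1 :=
      eventually_all.2 fun i => eventually_dotProduct_one_add_smul_mulVec_le_one (hy i)
        fun hi => hneg _ ⟨i, hi, rfl⟩
    obtain ⟨t, ⟨hpos, hdet⟩, hle⟩ := (((eventually_posDef_one_add_smul hG).and
      (eventually_one_lt_det_one_add_smul htrace)).and hfeas).exists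
    exact (hopt _ hpos hle).not_gt hdet
  rw [Set.image_image] at hmem
  obtain ⟨c, hc, hs, hsum⟩ := exists_weights_of_mem_convexHull_image hmem
  refine ⟨fun i => Fintype.card n * c i, fun i => mul_nonneg (Nat.cast_nonneg _) (hc i),
    fun i hi => hs i (right_ne_zero_of_mul hi), ?_⟩
  simp only [mul_smul, ← Finset.smul_sum]
  rw [hsum, smul_smul, mul_inv_cancel₀ (by positivity), one_smul]

end OptimalityConditions

section SqrtMatrix

variable {n : ℕ} {L : Matrix (Fin n) (Fin n) ℝ}

theorem transpose_sqrtMatrix (hL : L.PosDef) : (sqrtMatrix L hL)ᵀ = sqrtMatrix L hL := by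
  rw [sqrtMatrix, transpose_mul, transpose_mul, transpose_transpose, diagonal_transpose,
    Matrix.mul_assoc]

theorem sqrtMatrix_mul_self (hL : L.PosDef) : sqrtMatrix L hL * sqrtMatrix L hL = L := by
  set U : Matrix (Fin n) (Fin n) ℝ := hL.isHermitian.eigenvectorUnitary.1 with hU
  have horth : Uᵀ * U = 1 := by
    simpa only [star_eq_conjTranspose, conjTranspose_eq_transpose_of_trivial] using
      Unitary.coe_star_mul_self hL.isHermitian.eigenvectorUnitary
  have hspec := hL.isHermitian.spectral_theorem
  rw [Unitary.conjStarAlgAut_apply, star_eq_conjTranspose, conjTranspose_eq_transpose_of_trivial,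
    ← hU] at hspec
  have hdiag : diagonal (fun i => √(hL.isHermitian.eigenvalues i)) *
      diagonal (fun i => √(hL.isHermitian.eigenvalues i)) =
      diagonal (RCLike.ofReal ∘ hL.isHermitian.eigenvalues) := by
    rw [diagonal_mul_diagonal]
    congr 1
    ext i
    exact Real.mul_self_sqrt (hL.eigenvalues_pos i).le
  conv_rhs => rw [hspec, ← hdiag]
  rw [sqrtMatrix, ← hU]
  simp only [Matrix.mul_assoc]
  rw [← Matrix.mul_assoc Uᵀ U, horth, Matrix.one_mul]

theorem isUnit_det_sqrtMatrix (hL : L.PosDef) : IsUnit (sqrtMatrix L hL).det :=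
  isUnit_of_mul_isUnit_left (by rw [← det_mul, sqrtMatrix_mul_self]; exact hL.det_pos.ne'.isUnit)

theorem dotProduct_sqrtMatrix_mulVec (hL : L.PosDef) (M : Matrix (Fin n) (Fin n) ℝ)
    (x : Fin n → ℝ) :
    (sqrtMatrix L hL *ᵥ x) ⬝ᵥ M *ᵥ (sqrtMatrix L hL *ᵥ x) =
      x ⬝ᵥ (sqrtMatrix L hL * M * sqrtMatrix L hL) *ᵥ x := by
  conv_lhs => rw [dotProduct_comm, ← dotProduct_transpose_mulVec, transpose_sqrtMatrix]
  rw [mulVec_mulVec, mulVec_mulVec, Matrix.mul_assoc]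

theorem dotProduct_sqrtMatrix_mulVec_self (hL : L.PosDef) (x : Fin n → ℝ) :
    (sqrtMatrix L hL *ᵥ x) ⬝ᵥ (sqrtMatrix L hL *ᵥ x) = x ⬝ᵥ L *ᵥ x := by
  simpa [sqrtMatrix_mul_self] using dotProduct_sqrtMatrix_mulVec hL 1 x

theorem posDef_sqrtMatrix_mul_mul (hL : L.PosDef) {M : Matrix (Fin n) (Fin n) ℝ} (hM : M.PosDef) :
    (sqrtMatrix L hL * M * sqrtMatrix L hL).PosDef := by
  simpa only [conjTranspose_eq_transpose_of_trivial, transpose_sqrtMatrix] using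
    hM.conjTranspose_mul_mul_same (B := sqrtMatrix L hL) (mulVec_injective_iff_isUnit.2
      ((isUnit_iff_isUnit_det _).2 (isUnit_det_sqrtMatrix hL)))

end SqrtMatrix

namespace MVEEOptimal

variable {n : ℕ} {L : Matrix (Fin n) (Fin n) ℝ} {s : Set (Fin n → ℝ)}

theorem det_le_one (hL : MVEEOptimal s L) {M : Matrix (Fin n) (Fin n) ℝ} (hM : M.PosDef)
    (h : ∀ x ∈ s, (sqrtMatrix L hL.1.1 *ᵥ x) ⬝ᵥ M *ᵥ (sqrtMatrix L hL.1.1 *ᵥ x) ≤ 1) :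
    M.det ≤ 1 := by
  set B := sqrtMatrix L hL.1.1 with hB
  have hBM : (B * M * B).PosDef := posDef_sqrtMatrix_mul_mul hL.1.1 hM
  have hlog := hL.2 (B * M * B) ⟨hBM, fun x hx => by
    rw [← dotProduct_sqrtMatrix_mulVec]; exact h x hx⟩
  have hdet : L.det * M.det ≤ L.det * 1 := by
    calc L.det * M.det = (B * M * B).det := by
          rw [← sqrtMatrix_mul_self hL.1.1, ← hB, det_mul, det_mul, det_mul]; ring
      _ ≤ L.det := (Real.log_le_log_iff hBM.det_pos hL.1.1.det_pos).1 (neg_le_neg_iff.1 hlog)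
      _ = L.det * 1 := (mul_one _).symm
  exact le_of_mul_le_mul_left hdet hL.1.1.det_pos

theorem exists_weights [NeZero n] {ι : Type*} [Fintype ι] {p : ι → Fin n → ℝ}
    (hL : MVEEOptimal (Set.range p) L) :
    ∃ u : ι → ℝ, (∀ i, 0 ≤ u i) ∧ (∀ i, u i ≠ 0 → p i ⬝ᵥ L *ᵥ p i = 1) ∧
      ∀ v, ∑ i, u i * ((sqrtMatrix L hL.1.1 *ᵥ p i) ⬝ᵥ v) ^ 2 = v ⬝ᵥ v := by
  obtain ⟨u, hu, hactive, hframe⟩ :=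
    exists_weights_of_det_le_one (fun i => sqrtMatrix L hL.1.1 *ᵥ p i)
      (fun i => (dotProduct_sqrtMatrix_mulVec_self hL.1.1 _).trans_le (hL.1.2 _ ⟨i, rfl⟩))
      fun M hM hle => hL.det_le_one hM (by rintro _ ⟨i, rfl⟩; exact hle i)
  refine ⟨u, hu, fun i hi => (dotProduct_sqrtMatrix_mulVec_self _ _).symm.trans (hactive i hi),
    fun v => ?_⟩
  have hquad := congrArg (fun M => v ⬝ᵥ M *ᵥ v) hframe
  simp only [one_mulVec, sum_mulVec, dotProduct_sum, smul_mulVec, dotProduct_smul, smul_eq_mul,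
    vecMulVec_mulVec, op_smul_eq_smul] at hquad
  rw [← hquad]
  exact Finset.sum_congr rfl fun i _ => by rw [dotProduct_comm v, sq]

end MVEEOptimal

section Existence

theorem abs_apply_le_of_posSemidef {n : Type*} {X : Matrix n n ℝ} (hX : X.PosSemidef) {c : ℝ}
    (hdiag : ∀ j, X j j ≤ c) (j k : n) : |X j k| ≤ c := by
  have hquad : ∀ s : ℝ, 0 ≤ X j j + s * X k j + s * (X j k + s * X k k) := fun s => by
    have hnonneg := (hX.submatrix ![j, k]).dotProduct_mulVec_nonneg ![1, s]
    rw [star_trivial, dotProduct_mulVec] at hnonneg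
    simpa [vecMul, dotProduct, Fin.sum_univ_two, mul_comm] using hnonneg
  have hsymm : X k j = X j k := by simpa using congrFun₂ hX.isHermitian j k
  rw [abs_le]
  constructor <;> linarith [hquad 1, hquad (-1), hdiag j, hdiag k]

theorem isClosed_posSemidef {n : Type*} [Finite n] :
    IsClosed {L : Matrix n n ℝ | L.PosSemidef} := by
  have := Fintype.ofFinite n
  simp only [posSemidef_iff_dotProduct_mulVec, star_trivial, isHermitian_iff_isSymm, IsSymm,
    Set.ofPred_and, Set.ofPred_forall]
  refine (isClosed_eq continuous_id.matrix_transpose continuous_id).inter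
    (isClosed_iInter fun x => isClosed_le continuous_const ?_)
  exact continuous_const.dotProduct (continuous_id.matrix_mulVec continuous_const)

variable {n ι : Type*} [Fintype n] {p : ι → n → ℝ}

theorem isClosed_posSemidef_dotProduct_mulVec_le :
    IsClosed {L : Matrix n n ℝ | L.PosSemidef ∧ ∀ i, p i ⬝ᵥ L *ᵥ p i ≤ 1} := by
  simp only [Set.ofPred_and, Set.ofPred_forall]
  refine isClosed_posSemidef.inter (isClosed_iInter fun i => isClosed_le ?_ continuous_const)
  exact continuous_const.dotProduct (continuous_id.matrix_mulVec continuous_const)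

/-- In the coordinates in which some of the `p i` are the unit vectors, the diagonal entries of a
feasible matrix are at most `1`, hence all its entries are. -/
theorem isCompact_posSemidef_dotProduct_mulVec_le [DecidableEq n] (e : n → ι)
    (he : IsUnit (of fun k j => p (e j) k).det) :
    IsCompact {L : Matrix n n ℝ | L.PosSemidef ∧ ∀ i, p i ⬝ᵥ L *ᵥ p i ≤ 1} := by
  set H : Matrix n n ℝ := of fun k j => p (e j) k
  have hbox : IsCompact (Set.univ.pi fun _ => Set.univ.pi fun _ => Set.Icc (-1) 1 :
      Set (Matrix n n ℝ)) :=
    isCompact_univ_pi fun _ => isCompact_univ_pi fun _ => isCompact_Icc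
  refine (hbox.image (f := fun X : Matrix n n ℝ => (H⁻¹)ᵀ * X * H⁻¹)
    (by fun_prop)).of_isClosed_subset isClosed_posSemidef_dotProduct_mulVec_le ?_
  rintro L ⟨hL, hLp⟩
  refine ⟨Hᵀ * L * H, fun j _ k _ => abs_le.1 (abs_apply_le_of_posSemidef ?_ (fun j => ?_) j k), ?_⟩
  · simpa only [conjTranspose_eq_transpose_of_trivial] using hL.conjTranspose_mul_mul_same H
  · refine le_trans (le_of_eq ?_) (hLp (e j))
    rw [Matrix.mul_assoc, mul_apply, dotProduct]
    rfl
  · have hright : H * H⁻¹ = 1 := mul_nonsing_inv _ he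
    calc (H⁻¹)ᵀ * (Hᵀ * L * H) * H⁻¹ = (H * H⁻¹)ᵀ * L * (H * H⁻¹) := by
          simp only [transpose_mul, Matrix.mul_assoc]
      _ = L := by rw [hright, transpose_one, Matrix.one_mul, Matrix.mul_one]

theorem exists_pos_forall_smul_one_dotProduct_le [DecidableEq n] [Finite ι] (p : ι → n → ℝ) :
    ∃ c : ℝ, 0 < c ∧ ∀ i, p i ⬝ᵥ (c • (1 : Matrix n n ℝ)) *ᵥ p i ≤ 1 := by
  obtain ⟨b, hb⟩ := (Set.finite_range fun i => p i ⬝ᵥ p i).bddAbove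
  refine ⟨(1 + |b|)⁻¹, by positivity, fun i => ?_⟩
  rw [smul_mulVec, one_mulVec, dotProduct_smul, smul_eq_mul, inv_mul_eq_div,
    div_le_one (by positivity)]
  linarith [hb ⟨i, rfl⟩, le_abs_self b]

end Existence

theorem exists_mveeOptimal {n : ℕ} {ι : Type*} [Finite ι] {p : ι → Fin n → ℝ} (e : Fin n → ι)
    (he : IsUnit (of fun k j => p (e j) k).det) : ∃ L, MVEEOptimal (Set.range p) L := by
  obtain ⟨c, hc, hcp⟩ := exists_pos_forall_smul_one_dotProduct_le p
  have hstart : (c • (1 : Matrix (Fin n) (Fin n) ℝ)).PosDef := PosDef.one.smul hc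
  obtain ⟨L, hL, hmax⟩ := (isCompact_posSemidef_dotProduct_mulVec_le e he).exists_isMaxOn
    ⟨_, hstart.posSemidef, hcp⟩ (continuous_id.matrix_det (n := Fin n) (R := ℝ)).continuousOn
  have hdet : 0 < L.det := hstart.det_pos.trans_le (hmax ⟨hstart.posSemidef, hcp⟩)
  refine ⟨L, ⟨hL.1.posDef_iff_det_ne_zero.2 hdet.ne', by rintro _ ⟨i, rfl⟩; exact hL.2 i⟩,
    fun M hM => neg_le_neg (Real.log_le_log hM.1.det_pos (hmax ?_))⟩
  exact ⟨hM.1.posSemidef, fun i => hM.2 _ ⟨i, rfl⟩⟩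

/-! ### Norms and singular values -/

open scoped Matrix.Norms.L2Operator

section EuclideanNorms

variable {d m : ℕ}

theorem vecNorm2_nonneg (x : Fin d → ℝ) : 0 ≤ vecNorm2 x := norm_nonneg _

theorem vecNorm2_eq_zero {x : Fin d → ℝ} : vecNorm2 x = 0 ↔ x = 0 :=
  norm_eq_zero.trans (WithLp.toLp_eq_zero 2)

theorem sq_vecNorm2 (x : Fin d → ℝ) : vecNorm2 x ^ 2 = ∑ j, x j ^ 2 :=
  EuclideanSpace.real_norm_sq_eq _

theorem vecNorm2_add_le (x y : Fin d → ℝ) : vecNorm2 (x + y) ≤ vecNorm2 x + vecNorm2 y :=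
  norm_add_le (WithLp.toLp 2 x) (WithLp.toLp 2 y)

theorem vecNorm2_sub_le (x y : Fin d → ℝ) : vecNorm2 (x - y) ≤ vecNorm2 x + vecNorm2 y :=
  norm_sub_le (WithLp.toLp 2 x) (WithLp.toLp 2 y)

theorem vecNorm2_mulVec_le (A : Matrix (Fin d) (Fin m) ℝ) (x : Fin m → ℝ) :
    vecNorm2 (A *ᵥ x) ≤ ‖A‖ * vecNorm2 x :=
  A.l2_opNorm_mulVec (WithLp.toLp 2 x)

theorem l2_opNorm_le_of_vecNorm2_mulVec_le {A : Matrix (Fin d) (Fin m) ℝ} {c : ℝ} (hc : 0 ≤ c)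
    (h : ∀ x, vecNorm2 (A *ᵥ x) ≤ c * vecNorm2 x) : ‖A‖ ≤ c :=
  ContinuousLinearMap.opNorm_le_bound _ hc fun x => h x.ofLp

theorem l2_opNorm_transpose (A : Matrix (Fin d) (Fin m) ℝ) : ‖Aᵀ‖ = ‖A‖ := by
  rw [← conjTranspose_eq_transpose_of_trivial, l2_opNorm_conjTranspose]

theorem vecNorm2_mulVec_of_transpose_mul_self {Q : Matrix (Fin d) (Fin m) ℝ} (hQ : Qᵀ * Q = 1)
    (x : Fin m → ℝ) : vecNorm2 (Q *ᵥ x) = vecNorm2 x := by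
  have isometry : Q *ᵥ x ⬝ᵥ Q *ᵥ x = x ⬝ᵥ x := by
    rw [dotProduct_mulVec, vecMul_mulVec, hQ, vecMul_one]
  rw [← sq_eq_sq₀ (vecNorm2_nonneg _) (vecNorm2_nonneg _), sq_vecNorm2, sq_vecNorm2]
  simpa only [dotProduct, ← sq] using isometry

theorem l2_opNorm_le_one_of_transpose_mul_self {Q : Matrix (Fin d) (Fin m) ℝ} (hQ : Qᵀ * Q = 1) :
    ‖Q‖ ≤ 1 :=
  l2_opNorm_le_of_vecNorm2_mulVec_le zero_le_one fun x => by
    rw [vecNorm2_mulVec_of_transpose_mul_self hQ, one_mul]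

theorem mul_vecNorm2_le_vecNorm2_diagonal_mulVec {s : Fin m → ℝ} {c : ℝ} (hc : 0 ≤ c)
    (hs : ∀ k, c ≤ s k) (x : Fin m → ℝ) : c * vecNorm2 x ≤ vecNorm2 (diagonal s *ᵥ x) := by
  refine le_of_sq_le_sq ?_ (vecNorm2_nonneg _)
  simp only [mul_pow, sq_vecNorm2, Finset.mul_sum, mulVec_diagonal]
  gcongr with k
  exact hs k

theorem exists_ne_zero_mulVec_eq_zero {A : Matrix (Fin d) (Fin m) ℝ} (hA : A.rank < m) :
    ∃ x, x ≠ 0 ∧ A *ᵥ x = 0 := by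
  have hker : A.mulVecLin.ker ≠ ⊥ := fun h => by
    have := LinearMap.finrank_range_of_inj (LinearMap.ker_eq_bot.1 h)
    rw [Module.finrank_fin_fun] at this
    exact hA.ne this
  obtain ⟨x, hx, hx0⟩ := (Submodule.ne_bot_iff _).1 hker
  exact ⟨x, hx0, hx⟩

end EuclideanNorms

section SingularValues

variable {E F : Type*} [NormedAddCommGroup E] [InnerProductSpace ℝ E] [FiniteDimensional ℝ E]
  [NormedAddCommGroup F] [InnerProductSpace ℝ F] [FiniteDimensional ℝ F]

theorem inner_map_eigenvectorBasis (T : E →ₗ[ℝ] F) {n : ℕ} (hn : Module.finrank ℝ E = n)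
    (i j : Fin n) :
    ⟪T (T.isSymmetric_adjoint_comp_self.eigenvectorBasis hn i),
      T (T.isSymmetric_adjoint_comp_self.eigenvectorBasis hn j)⟫_ℝ =
      if i = j then T.singularValues i ^ 2 else 0 := by
  rw [← LinearMap.adjoint_inner_left, ← LinearMap.comp_apply,
    LinearMap.IsSymmetric.apply_eigenvectorBasis, T.sq_singularValues_fin hn, inner_smul_left,
    orthonormal_iff_ite.1 (OrthonormalBasis.orthonormal _), mul_ite, mul_one, mul_zero]
  rfl

theorem sq_norm_map_eq_sum (T : E →ₗ[ℝ] F) {n : ℕ} (hn : Module.finrank ℝ E = n) (x : E) :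
    ‖T x‖ ^ 2 = ∑ i : Fin n, T.singularValues i ^ 2 *
      ⟪T.isSymmetric_adjoint_comp_self.eigenvectorBasis hn i, x⟫_ℝ ^ 2 := by
  set b := T.isSymmetric_adjoint_comp_self.eigenvectorBasis hn with hb
  have expansion : T x = ∑ i, ⟪b i, x⟫_ℝ • T (b i) := by
    conv_lhs => rw [← b.sum_repr' x]
    simp only [map_sum, map_smul]
  rw [expansion, ← real_inner_self_eq_norm_sq, sum_inner]
  refine Finset.sum_congr rfl fun i _ => ?_
  simp only [inner_sum, real_inner_smul_left, real_inner_smul_right, hb,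
    inner_map_eigenvectorBasis, mul_ite, mul_zero, Finset.sum_ite_eq, Finset.mem_univ, if_true]
  ring

theorem norm_map_le_singularValues_zero (T : E →ₗ[ℝ] F) (x : E) :
    ‖T x‖ ≤ T.singularValues 0 * ‖x‖ := by
  refine le_of_sq_le_sq ?_ (mul_nonneg (T.singularValues_nonneg 0) (norm_nonneg _))
  rw [sq_norm_map_eq_sum T rfl, mul_pow,
    ← (T.isSymmetric_adjoint_comp_self.eigenvectorBasis rfl).sum_sq_inner_right x, Finset.mul_sum]
  gcongr with i
  · exact T.singularValues_nonneg _
  · exact T.singularValues_antitone (Nat.zero_le _)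

theorem singularValues_last_mul_norm_le (T : E →ₗ[ℝ] F) (x : E) :
    T.singularValues (Module.finrank ℝ E - 1) * ‖x‖ ≤ ‖T x‖ := by
  refine le_of_sq_le_sq ?_ (norm_nonneg _)
  rw [sq_norm_map_eq_sum T rfl, mul_pow,
    ← (T.isSymmetric_adjoint_comp_self.eigenvectorBasis rfl).sum_sq_inner_right x, Finset.mul_sum]
  gcongr with i
  · exact T.singularValues_nonneg _
  · exact T.singularValues_antitone (by lia)

theorem exists_orthonormalBasis_inner_map (T : E →ₗ[ℝ] F) {d m : ℕ}
    (hd : Module.finrank ℝ F = d) (hm : Module.finrank ℝ E = m) :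
    ∃ (b : OrthonormalBasis (Fin m) ℝ E) (c : OrthonormalBasis (Fin d) ℝ F),
      ∀ k l, ⟪c k, T (b l)⟫_ℝ = if (k : ℕ) = l then T.singularValues k else 0 := by
  set b := T.isSymmetric_adjoint_comp_self.eigenvectorBasis hm
  set s := T.singularValues
  have lt_of_pos : ∀ k, 0 < s k → k < d ∧ k < m := fun k hk => by
    have := T.singularValues_pos_iff_lt_finrank_range.1 hk
    have := Submodule.finrank_le T.range
    have := T.finrank_range_le
    lia
  have gram : ∀ i j : Fin m, ⟪T (b i), T (b j)⟫_ℝ = if i = j then s i ^ 2 else 0 :=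
    inner_map_eigenvectorBasis T hm
  let leftVector : Fin d → F := fun k => if h : (k : ℕ) < m then (s k)⁻¹ • T (b ⟨k, h⟩) else 0
  have orthonormal : Orthonormal ℝ (Set.domRestrict {k : Fin d | 0 < s k} leftVector) := by
    rw [orthonormal_iff_ite]
    rintro ⟨k, hk⟩ ⟨l, hl⟩
    have hsk : s k ≠ 0 := ne_of_gt hk
    change ⟪leftVector k, leftVector l⟫_ℝ = _
    simp only [leftVector, (lt_of_pos _ hk).2, (lt_of_pos _ hl).2, dif_pos, real_inner_smul_left,
      real_inner_smul_right, gram, Fin.mk.injEq, Subtype.mk.injEq, Fin.val_inj]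
    split_ifs with hkl
    · subst hkl
      field_simp
    · simp only [mul_zero]
  obtain ⟨c, hc⟩ := orthonormal.exists_orthonormalBasis_extension_of_card_eq
    (by rw [hd, Fintype.card_fin])
  refine ⟨b, c, fun k l => ?_⟩
  rcases (T.singularValues_nonneg l).eq_or_lt with hl | hl
  · have hTb : T (b l) = 0 := inner_self_eq_zero.1 ((gram l l).trans (by simp [s, ← hl]))
    rw [hTb, inner_zero_right]
    split_ifs with hkl
    · rw [hkl, ← hl]
    · rfl
  · obtain ⟨hld, hlm⟩ := lt_of_pos l hl
    have hTb : T (b l) = s l • c ⟨l, hld⟩ := by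
      rw [hc ⟨l, hld⟩ hl]
      simp only [leftVector, hlm, dif_pos, Fin.eta]
      exact (smul_inv_smul₀ hl.ne' _).symm
    rw [hTb, real_inner_smul_right, orthonormal_iff_ite.1 c.orthonormal, mul_ite, mul_one, mul_zero]
    simp only [Fin.ext_iff]
    split_ifs with hkl
    · rw [hkl]
    · rfl

end SingularValues

section SigmaMinMax

variable {d r : ℕ} {F : Matrix (Fin d) (Fin r) ℝ}

theorem l2_opNorm_le_sigmaMax (F : Matrix (Fin d) (Fin r) ℝ) : ‖F‖ ≤ sigmaMax F :=
  l2_opNorm_le_of_vecNorm2_mulVec_le (LinearMap.singularValues_nonneg _ 0) fun x =>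
    norm_map_le_singularValues_zero (toEuclideanLin F) (WithLp.toLp 2 x)

theorem sigmaMin_eq_of_rank_eq (hF : F.rank = r) :
    sigmaMin F = (toEuclideanLin F).singularValues (r - 1) := by
  rw [sigmaMin, min_eq_right (hF ▸ F.rank_le_height)]

theorem sigmaMin_mul_vecNorm2_le (hF : F.rank = r) (x : Fin r → ℝ) :
    sigmaMin F * vecNorm2 x ≤ vecNorm2 (F *ᵥ x) := by
  have h := singularValues_last_mul_norm_le (toEuclideanLin F) (WithLp.toLp 2 x)
  rw [finrank_euclideanSpace_fin, ← sigmaMin_eq_of_rank_eq hF] at h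
  exact h

theorem sigmaMin_pos [NeZero r] (hF : F.rank = r) : 0 < sigmaMin F := by
  have hrank := F.rank_eq_finrank_range_toLin (EuclideanSpace.basisFun (Fin d) ℝ).toBasis
    (EuclideanSpace.basisFun (Fin r) ℝ).toBasis
  rw [← toEuclideanLin_eq_toLin_orthonormal, hF] at hrank
  rw [sigmaMin_eq_of_rank_eq hF, LinearMap.singularValues_pos_iff_lt_finrank_range, ← hrank]
  exact Nat.sub_one_lt (NeZero.ne r)

end SigmaMinMax

/-! ### Singular value decompositions -/

section SVD

variable {d m t : ℕ} {A : Matrix (Fin d) (Fin m) ℝ}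

theorem of_orthonormalBasis_mem_orthogonalGroup
    (b : OrthonormalBasis (Fin d) ℝ (EuclideanSpace ℝ (Fin d))) :
    (of fun i k => b k i) ∈ orthogonalGroup (Fin d) ℝ := by
  rw [mem_orthogonalGroup_iff']
  ext k l
  rw [one_apply, ← orthonormal_iff_ite.1 b.orthonormal k l, real_inner_comm]
  rfl

theorem exists_isSVD (A : Matrix (Fin d) (Fin m) ℝ) : ∃ U σ V, IsSVD A U σ V := by
  set T := toEuclideanLin A
  obtain ⟨b, c, hbc⟩ := exists_orthonormalBasis_inner_map T finrank_euclideanSpace_fin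
    finrank_euclideanSpace_fin
  set U : Matrix (Fin d) (Fin d) ℝ := of fun i k => c k i
  set V : Matrix (Fin m) (Fin m) ℝ := of fun i k => b k i
  have hU : U ∈ orthogonalGroup (Fin d) ℝ := of_orthonormalBasis_mem_orthogonalGroup c
  have hV : V ∈ orthogonalGroup (Fin m) ℝ := of_orthonormalBasis_mem_orthogonalGroup b
  refine ⟨U, fun k => T.singularValues k, V, hU, hV, fun k => T.singularValues_nonneg _,
    fun k l hkl => T.singularValues_antitone hkl, ?_⟩
  have hdiag : rectDiagonal (fun k => T.singularValues k) = Uᵀ * (A * V) := by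
    ext k l
    have hentry : (Uᵀ * (A * V)) k l = ⟪c k, T (b l)⟫_ℝ := by
      rw [real_inner_comm]
      rfl
    rw [hentry, hbc]
    rfl
  rw [hdiag, Matrix.mul_assoc, Matrix.mul_assoc, Matrix.mul_assoc,
    (mem_orthogonalGroup_iff _ _).1 hV, Matrix.mul_one, ← Matrix.mul_assoc,
    (mem_orthogonalGroup_iff _ _).1 hU, Matrix.one_mul]

theorem exists_isTruncatedSVD (A : Matrix (Fin d) (Fin m) ℝ) (ht : t ≤ min d m) :
    ∃ P : Matrix (Fin t) (Fin m) ℝ, IsTruncatedSVD A t P := by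
  obtain ⟨U, σ, V, h⟩ := exists_isSVD A
  exact ⟨_, U, σ, V, ht, h, rfl⟩

/-- A singular value decomposition in which only the columns of the orthogonal factors that meet
the diagonal are kept, so that the middle factor is a square diagonal matrix. -/
structure IsThinSVD (A : Matrix (Fin d) (Fin m) ℝ) (U : Matrix (Fin d) (Fin t) ℝ) (σ : Fin t → ℝ)
    (V : Matrix (Fin m) (Fin t) ℝ) : Prop where
  left : Uᵀ * U = 1
  right : Vᵀ * V = 1
  nonneg : ∀ k, 0 ≤ σ k
  antitone : Antitone σ
  eq_mul : A = U * diagonal σ * Vᵀ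

theorem rectDiagonal_eq_mul (σ : Fin (min d m) → ℝ) :
    rectDiagonal σ = (1 : Matrix (Fin d) (Fin d) ℝ).submatrix id (Fin.castLE (min_le_left d m)) *
      diagonal σ *
      ((1 : Matrix (Fin m) (Fin m) ℝ).submatrix id (Fin.castLE (min_le_right d m)))ᵀ := by
  ext i j
  rw [mul_apply]
  simp only [mul_diagonal, submatrix_apply, transpose_apply, one_apply, id_eq, ite_mul, one_mul,
    zero_mul, mul_ite, mul_one, mul_zero, rectDiagonal, of_apply, Fin.ext_iff, Fin.val_castLE]
  split_ifs with hij
  · rw [Finset.sum_eq_single ⟨i, lt_min i.isLt (hij ▸ j.isLt)⟩]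
    · simp [hij]
    · intro k _ hk
      exact if_neg fun hjk => hk (Fin.ext (hjk.symm.trans hij.symm))
    · simp
  · refine (Finset.sum_eq_zero fun k _ => ?_).symm
    split_ifs <;> first | rfl | lia

theorem submatrix_transpose_mul_submatrix {k : ℕ} {U : Matrix (Fin d) (Fin t) ℝ} (hU : Uᵀ * U = 1)
    {e : Fin k → Fin t} (he : Function.Injective e) :
    (U.submatrix id e)ᵀ * U.submatrix id e = 1 := by
  rw [← submatrix_one e he, ← hU]
  rfl

theorem mul_submatrix_id_one {k : ℕ} (M : Matrix (Fin d) (Fin m) ℝ) (e : Fin k → Fin m) :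
    M * (1 : Matrix (Fin m) (Fin m) ℝ).submatrix id e = M.submatrix id e := by
  conv_rhs => rw [← Matrix.mul_one M]
  rfl

theorem IsSVD.isThinSVD {U σ V} (h : IsSVD A U σ V) :
    IsThinSVD A (U.submatrix id (Fin.castLE (min_le_left d m))) σ
      (V.submatrix id (Fin.castLE (min_le_right d m))) := by
  obtain ⟨hU, hV, nonneg, antitone, eq_mul⟩ := h
  refine ⟨submatrix_transpose_mul_submatrix ((mem_orthogonalGroup_iff' _ _).1 hU)
    (Fin.castLE_injective _), submatrix_transpose_mul_submatrix
    ((mem_orthogonalGroup_iff' _ _).1 hV) (Fin.castLE_injective _), nonneg, antitone, ?_⟩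
  rw [eq_mul, rectDiagonal_eq_mul, Matrix.mul_assoc, Matrix.mul_assoc, Matrix.mul_assoc,
    Matrix.mul_assoc, ← transpose_mul, ← Matrix.mul_assoc U, mul_submatrix_id_one,
    mul_submatrix_id_one]

section Thin

variable {U : Matrix (Fin d) (Fin t) ℝ} {σ : Fin t → ℝ} {V : Matrix (Fin m) (Fin t) ℝ}

theorem IsThinSVD.transpose_mul (h : IsThinSVD A U σ V) : Uᵀ * A = diagonal σ * Vᵀ := by
  rw [h.eq_mul, Matrix.mul_assoc, ← Matrix.mul_assoc Uᵀ, h.left, Matrix.one_mul]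

theorem IsThinSVD.mul_right (h : IsThinSVD A U σ V) : A * V = U * diagonal σ := by
  rw [h.eq_mul, Matrix.mul_assoc, h.right, Matrix.mul_one]

/-- The lower half of the Eckart–Young theorem: on the span of the first `k + 1` right singular
vectors `A` does not shrink norms below the factor `σ k`, and `M` has a kernel vector there. -/
theorem IsThinSVD.le_l2_opNorm_sub (h : IsThinSVD A U σ V) {k : Fin t}
    {M : Matrix (Fin d) (Fin m) ℝ} (hM : M.rank ≤ k) : σ k ≤ ‖A - M‖ := by
  let e : Fin (k + 1) → Fin t := Fin.castLE k.isLt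
  have he : Function.Injective e := Fin.castLE_injective _
  obtain ⟨c, hc, hMc⟩ := exists_ne_zero_mulVec_eq_zero (A := M * V.submatrix id e)
    (Nat.lt_succ_of_le ((rank_mul_le_left _ _).trans hM))
  have hAV : A * V.submatrix id e = U.submatrix id e * diagonal (σ ∘ e) := by
    ext i j
    have := congrFun₂ h.mul_right i (e j)
    rw [mul_diagonal] at this ⊢
    exact this
  have hpos : 0 < vecNorm2 c := (vecNorm2_nonneg c).lt_of_ne' fun h0 => hc (vecNorm2_eq_zero.1 h0)
  refine le_of_mul_le_mul_right ?_ hpos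
  calc σ k * vecNorm2 c
      ≤ vecNorm2 (diagonal (σ ∘ e) *ᵥ c) := mul_vecNorm2_le_vecNorm2_diagonal_mulVec (h.nonneg k)
        (fun j => h.antitone (Fin.le_def.2 (Nat.lt_succ_iff.1 j.isLt))) c
    _ = vecNorm2 ((A - M) *ᵥ V.submatrix id e *ᵥ c) := by
        rw [sub_mulVec, mulVec_mulVec, mulVec_mulVec, hMc, sub_zero, hAV, ← mulVec_mulVec,
          vecNorm2_mulVec_of_transpose_mul_self (submatrix_transpose_mul_submatrix h.left he)]
    _ ≤ ‖A - M‖ * vecNorm2 c := by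
        refine (vecNorm2_mulVec_le _ _).trans_eq ?_
        rw [vecNorm2_mulVec_of_transpose_mul_self (submatrix_transpose_mul_submatrix h.right he)]

theorem submatrix_mul_diagonal_mul_transpose {r : ℕ} (hr : r ≤ t) (U : Matrix (Fin d) (Fin t) ℝ)
    (σ : Fin t → ℝ) (V : Matrix (Fin m) (Fin t) ℝ) :
    U.submatrix id (Fin.castLE hr) * (diagonal (σ ∘ Fin.castLE hr) *
      (V.submatrix id (Fin.castLE hr))ᵀ) =
      U * diagonal (fun k : Fin t => if (k : ℕ) < r then σ k else 0) * Vᵀ := by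
  ext i j
  rw [← Matrix.mul_assoc, mul_apply, mul_apply]
  simp only [mul_diagonal]
  refine Fintype.sum_of_injective (Fin.castLE hr) (Fin.castLE_injective hr) _ _ (fun k hk => ?_)
    fun k => ?_
  · rw [if_neg fun hkr => hk ⟨⟨k, hkr⟩, rfl⟩, mul_zero, zero_mul]
  · rw [if_pos (by exact k.isLt)]
    rfl

theorem IsThinSVD.l2_opNorm_sub_truncation_le (h : IsThinSVD A U σ V) {r : ℕ} (hr : r ≤ t)
    {M : Matrix (Fin d) (Fin m) ℝ} (hM : M.rank ≤ r) :
    ‖A - U.submatrix id (Fin.castLE hr) * (diagonal (σ ∘ Fin.castLE hr) *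
      (V.submatrix id (Fin.castLE hr))ᵀ)‖ ≤ ‖A - M‖ := by
  let tail : Fin t → ℝ := fun k => if (k : ℕ) < r then 0 else σ k
  have hres : A - U.submatrix id (Fin.castLE hr) * (diagonal (σ ∘ Fin.castLE hr) *
      (V.submatrix id (Fin.castLE hr))ᵀ) = U * diagonal tail * Vᵀ := by
    rw [submatrix_mul_diagonal_mul_transpose, h.eq_mul, ← Matrix.sub_mul, ← Matrix.mul_sub,
      diagonal_sub]
    congr! 4 with k
    by_cases hk : (k : ℕ) < r <;> simp [tail, hk]
  have htail : ‖tail‖ ≤ ‖A - M‖ := by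
    refine (pi_norm_le_iff_of_nonneg (norm_nonneg _)).2 fun k => ?_
    by_cases hk : (k : ℕ) < r
    · simp [tail, hk]
    · simpa only [tail, hk, if_false, Real.norm_of_nonneg (h.nonneg k)] using
        h.le_l2_opNorm_sub (hM.trans (not_lt.1 hk))
  rw [hres]
  calc ‖U * diagonal tail * Vᵀ‖ ≤ ‖U‖ * ‖diagonal tail‖ * ‖Vᵀ‖ :=
        (l2_opNorm_mul _ _).trans (by gcongr; exact l2_opNorm_mul _ _)
    _ ≤ 1 * ‖A - M‖ * 1 := by
        rw [l2_opNorm_diagonal, l2_opNorm_transpose]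
        gcongr
        · exact l2_opNorm_le_one_of_transpose_mul_self h.left
        · exact l2_opNorm_le_one_of_transpose_mul_self h.right
    _ = ‖A - M‖ := by rw [one_mul, mul_one]

end Thin

/-- `P` holds the coordinates of the columns of `A` in the orthonormal basis formed by the columns
of `R`, up to an error `δ`. -/
structure IsOrthonormalFactor {r : ℕ} (A : Matrix (Fin d) (Fin m) ℝ) (R : Matrix (Fin d) (Fin r) ℝ)
    (P : Matrix (Fin r) (Fin m) ℝ) (δ : ℝ) : Prop where
  orthonormal : Rᵀ * R = 1
  eq_mul : P = Rᵀ * A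
  residual : ‖A - R * P‖ ≤ δ

theorem IsTruncatedSVD.exists_isOrthonormalFactor {r : ℕ} {P : Matrix (Fin r) (Fin m) ℝ}
    (h : IsTruncatedSVD A r P) {M : Matrix (Fin d) (Fin m) ℝ} (hM : M.rank ≤ r) :
    ∃ R, IsOrthonormalFactor A R P ‖A - M‖ := by
  obtain ⟨U, σ, V, hr, hsvd, rfl⟩ := h
  have thin := hsvd.isThinSVD
  refine ⟨(U.submatrix id (Fin.castLE (min_le_left d m))).submatrix id (Fin.castLE hr),
    submatrix_transpose_mul_submatrix thin.left (Fin.castLE_injective hr), ?_,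
    thin.l2_opNorm_sub_truncation_le hr hM⟩
  ext k j
  have := congrFun₂ thin.transpose_mul (Fin.castLE hr k) j
  rw [diagonal_mul] at this ⊢
  exact this.symm

end SVD

/-! ### Perturbed separable matrices -/

/-- The columns of `W` are nonnegative with sums at most one, and its column `τ j` is the `j`-th
unit vector. These are the properties of `(I, K) Π` that do not depend on how the columns are
ordered. -/
structure IsVertexWeights {r m : ℕ} (W : Matrix (Fin r) (Fin m) ℝ) (τ : Fin r → Fin m) : Prop where
  nonneg : ∀ j i, 0 ≤ W j i
  sum_le : ∀ i, ∑ j, W j i ≤ 1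
  injective : Function.Injective τ
  submatrix : W.submatrix id τ = 1

theorem IsSeparable.exists_isVertexWeights {d m r : ℕ} {A : Matrix (Fin d) (Fin m) ℝ}
    {F : Matrix (Fin d) (Fin r) ℝ} (h : IsSeparable A F) :
    ∃ W τ, IsVertexWeights W τ ∧ A = F * W := by
  obtain ⟨hrm, K, π, rfl, hK, -, hsum⟩ := h
  let e : Fin r ⊕ Fin (m - r) ≃ Fin m := finSumFinEquiv.trans (finCongr (Nat.add_sub_cancel' hrm))
  have hW : ∀ j i, (identityBeside hrm K * π.permMatrix ℝ) j i =
      fromCols (1 : Matrix (Fin r) (Fin r) ℝ) K j (e.symm (π.symm i)) := fun j i => by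
    rw [Equiv.Perm.permMatrix, PEquiv.mul_toMatrix_toPEquiv]
    rfl
  refine ⟨_, fun j => π (e (Sum.inl j)), ⟨fun j i => ?_, fun i => ?_, ?_, ?_⟩, rfl⟩
  · rw [hW]
    rcases e.symm (π.symm i) with a | a
    · rw [fromCols_apply_inl, one_apply]
      positivity
    · exact hK j a
  · simp only [hW]
    rcases e.symm (π.symm i) with a | a
    · simp [one_apply]
    · exact hsum a
  · exact π.injective.comp (e.injective.comp Sum.inl_injective)
  · ext k j
    simp [hW]

section Selector

variable {r m : ℕ} {τ : Fin r → Fin m}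

/-- The matrix that selects the columns with indices `τ` when it is multiplied from the right. -/
def selector (τ : Fin r → Fin m) : Matrix (Fin m) (Fin r) ℝ :=
  (1 : Matrix (Fin m) (Fin m) ℝ).submatrix id τ

theorem mul_selector {d : ℕ} (M : Matrix (Fin d) (Fin m) ℝ) (τ : Fin r → Fin m) :
    M * selector τ = M.submatrix id τ :=
  mul_submatrix_id_one M τ

theorem IsVertexWeights.mul_selector {W : Matrix (Fin r) (Fin m) ℝ} (h : IsVertexWeights W τ) :
    W * selector τ = 1 :=
  (PrecondSPA.mul_selector W τ).trans h.submatrix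

theorem l2_opNorm_mul_selector_le {d : ℕ} (M : Matrix (Fin d) (Fin m) ℝ)
    (hτ : Function.Injective τ) : ‖M * selector τ‖ ≤ ‖M‖ := by
  have hsel : ‖selector τ‖ ≤ 1 := l2_opNorm_le_one_of_transpose_mul_self
    (submatrix_transpose_mul_submatrix (by rw [transpose_one, Matrix.one_mul]) hτ)
  exact (l2_opNorm_mul _ _).trans (mul_le_of_le_one_right (norm_nonneg _) hsel)

end Selector

section Frobenius

variable {d m n : ℕ}

/-- The Frobenius norm, as a function because `‖·‖` stands for the operator norm of matrices. -/
def frobNorm (A : Matrix (Fin d) (Fin m) ℝ) : ℝ :=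
  ‖(WithLp.toLp 2 (Function.uncurry A) : EuclideanSpace ℝ (Fin d × Fin m))‖

theorem frobNorm_nonneg (A : Matrix (Fin d) (Fin m) ℝ) : 0 ≤ frobNorm A := norm_nonneg _

theorem frobNorm_sub_le (A B : Matrix (Fin d) (Fin m) ℝ) :
    frobNorm (A - B) ≤ frobNorm A + frobNorm B :=
  norm_sub_le (WithLp.toLp 2 (Function.uncurry A)) (WithLp.toLp 2 (Function.uncurry B))

theorem sq_frobNorm_eq_sum_row (A : Matrix (Fin d) (Fin m) ℝ) :
    frobNorm A ^ 2 = ∑ i, vecNorm2 (A.row i) ^ 2 := by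
  simp only [sq_vecNorm2]
  exact (EuclideanSpace.real_norm_sq_eq _).trans (Fintype.sum_prod_type _)

theorem sq_frobNorm_eq_sum_col (A : Matrix (Fin d) (Fin m) ℝ) :
    frobNorm A ^ 2 = ∑ j, ‖colPoint A j‖ ^ 2 := by
  simp only [EuclideanSpace.real_norm_sq_eq]
  exact (EuclideanSpace.real_norm_sq_eq _).trans (Fintype.sum_prod_type_right _)

theorem frobNorm_mul_le (A : Matrix (Fin d) (Fin m) ℝ) (B : Matrix (Fin m) (Fin n) ℝ) :
    frobNorm (A * B) ≤ frobNorm A * ‖B‖ := by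
  refine le_of_sq_le_sq ?_ (mul_nonneg (frobNorm_nonneg A) (norm_nonneg B))
  rw [mul_pow, sq_frobNorm_eq_sum_row, sq_frobNorm_eq_sum_row, Finset.sum_mul]
  gcongr with i
  have hrow : (A * B).row i = Bᵀ *ᵥ A.row i := (mulVec_transpose B (A.row i)).symm
  rw [← mul_pow, hrow, mul_comm, ← l2_opNorm_transpose B]
  gcongr
  · exact vecNorm2_nonneg _
  · exact vecNorm2_mulVec_le _ _

end Frobenius

section Columns

variable {d m : ℕ}

theorem vecNorm2_eq_sqrt (x : Fin d → ℝ) : vecNorm2 x = √(∑ j, x j ^ 2) := by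
  rw [← sq_vecNorm2, Real.sqrt_sq (vecNorm2_nonneg x)]

theorem sum_smul_colPoint (A : Matrix (Fin d) (Fin m) ℝ) (z : Fin m → ℝ) :
    ∑ j, z j • colPoint A j = WithLp.toLp 2 (A *ᵥ z) := by
  ext a
  simp [colPoint, mulVec, dotProduct, mul_comm]

theorem vecNorm2_col_le (A : Matrix (Fin d) (Fin m) ℝ) (i : Fin m) :
    vecNorm2 (A.col i) ≤ ‖A‖ := by
  have hsingle : vecNorm2 (Pi.single i 1) = 1 := by
    simp [vecNorm2_eq_sqrt, Pi.single_apply]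
  simpa only [mulVec_single_one, hsingle, mul_one] using vecNorm2_mulVec_le A (Pi.single i 1)

theorem l2_opNorm_mul_le_of_transpose_mul_self {n : ℕ} {Q : Matrix (Fin d) (Fin m) ℝ}
    (hQ : Qᵀ * Q = 1) (M : Matrix (Fin m) (Fin n) ℝ) : ‖Q * M‖ ≤ ‖M‖ :=
  (l2_opNorm_mul _ _).trans
    (mul_le_of_le_one_left (norm_nonneg _) (l2_opNorm_le_one_of_transpose_mul_self hQ))

theorem l2_opNorm_transpose_mul_le_of_transpose_mul_self {n : ℕ} {Q : Matrix (Fin d) (Fin m) ℝ}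
    (hQ : Qᵀ * Q = 1) (M : Matrix (Fin d) (Fin n) ℝ) : ‖Qᵀ * M‖ ≤ ‖M‖ :=
  (l2_opNorm_mul _ _).trans (mul_le_of_le_one_left (norm_nonneg _)
    ((l2_opNorm_transpose Q).trans_le (l2_opNorm_le_one_of_transpose_mul_self hQ)))

theorem isUnit_det_of_mul_vecNorm2_le {G : Matrix (Fin d) (Fin d) ℝ} {s : ℝ} (hs : 0 < s)
    (hG : ∀ x, s * vecNorm2 x ≤ vecNorm2 (G *ᵥ x)) : IsUnit G.det := by
  rw [← isUnit_iff_isUnit_det, ← mulVec_injective_iff_isUnit,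
    ← coe_mulVecLin, ← LinearMap.ker_eq_bot, LinearMap.ker_eq_bot']
  intro x hx
  have hx0 := hG x
  rw [← mulVecLin_apply, hx, vecNorm2_eq_zero.2 rfl] at hx0
  exact vecNorm2_eq_zero.1 (le_antisymm (nonpos_of_mul_nonpos_right hx0 hs) (vecNorm2_nonneg x))

theorem l2_opNorm_inv_le_of_mul_vecNorm2_le {G : Matrix (Fin d) (Fin d) ℝ} {s : ℝ} (hs : 0 < s)
    (hG : ∀ x, s * vecNorm2 x ≤ vecNorm2 (G *ᵥ x)) : ‖G⁻¹‖ ≤ s⁻¹ := by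
  refine l2_opNorm_le_of_vecNorm2_mulVec_le (inv_nonneg.2 hs.le) fun x => ?_
  rw [← div_eq_inv_mul, le_div_iff₀' hs]
  refine (hG _).trans_eq ?_
  rw [mulVec_mulVec, mul_nonsing_inv _ (isUnit_det_of_mul_vecNorm2_le hs hG), one_mulVec]

end Columns

/-- Up to noise, `P` is separable with vertices the columns of `G`. The noise is measured in the
coordinates that turn the vertices into unit vectors, which do not change when both `P` and `G` are
multiplied from the left by the same preconditioner. -/
structure IsNearlySeparable {r m : ℕ} (P : Matrix (Fin r) (Fin m) ℝ) (G : Matrix (Fin r) (Fin r) ℝ)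
    (W : Matrix (Fin r) (Fin m) ℝ) (τ : Fin r → Fin m) (η : ℝ) : Prop where
  isUnit_det : IsUnit G.det
  weights : IsVertexWeights W τ
  noise : ‖G⁻¹ * P - W‖ ≤ η
  small : √r * η ≤ 1 / 1200

theorem sq_norm_colPoint_sqrtMatrix_mul {r m : ℕ} {L : Matrix (Fin r) (Fin r) ℝ} (hL : L.PosDef)
    (P : Matrix (Fin r) (Fin m) ℝ) (i : Fin m) :
    ‖colPoint (sqrtMatrix L hL * P) i‖ ^ 2 = P.col i ⬝ᵥ L *ᵥ P.col i := by
  rw [← dotProduct_sqrtMatrix_mulVec_self hL, ← real_inner_self_eq_norm_sq, inner_colPoint]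
  rfl

namespace IsNearlySeparable

variable {r m : ℕ} {G L : Matrix (Fin r) (Fin r) ℝ} {W P : Matrix (Fin r) (Fin m) ℝ}
  {τ : Fin r → Fin m} {η : ℝ}

theorem noise_nonneg (h : IsNearlySeparable P G W τ η) : 0 ≤ η := (norm_nonneg _).trans h.noise

theorem noise_le [NeZero r] (h : IsNearlySeparable P G W τ η) : η ≤ 1 / 1200 := by
  have : 1 ≤ √(r : ℝ) := Real.one_le_sqrt.2 (mod_cast NeZero.one_le)
  exact (le_mul_of_one_le_left h.noise_nonneg this).trans h.small

theorem mul_eq (h : IsNearlySeparable P G W τ η) (B : Matrix (Fin r) (Fin r) ℝ) :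
    B * P = B * G * W + B * G * (G⁻¹ * P - W) := by
  rw [← Matrix.mul_add, add_sub_cancel, Matrix.mul_assoc, mul_nonsing_inv_cancel_left _ _
    h.isUnit_det]

theorem isUnit_det_submatrix [NeZero r] (h : IsNearlySeparable P G W τ η) :
    IsUnit (P.submatrix id τ).det := by
  have hunit : IsUnit (1 - -((G⁻¹ * P - W) * selector τ)) := by
    refine isUnit_one_sub_of_norm_lt_one ?_
    rw [norm_neg]
    linarith [l2_opNorm_mul_selector_le (G⁻¹ * P - W) h.weights.injective, h.noise, h.noise_le]
  have heq : P.submatrix id τ = G * (1 - -((G⁻¹ * P - W) * selector τ)) := by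
    rw [sub_neg_eq_add, ← h.weights.mul_selector, ← Matrix.add_mul, add_sub_cancel,
      ← Matrix.mul_assoc, mul_nonsing_inv_cancel_left _ _ h.isUnit_det, mul_selector]
  rw [heq, det_mul]
  exact h.isUnit_det.mul ((isUnit_iff_isUnit_det _).1 hunit)

/-- The points `τ j` are within a fraction `η` of the vertices, and they lie in the unit ball. -/
theorem one_sub_mul_frobNorm_le (h : IsNearlySeparable P G W τ η) {B : Matrix (Fin r) (Fin r) ℝ}
    (hB : ∀ i, ‖colPoint (B * P) i‖ ≤ 1) : (1 - η) * frobNorm (B * G) ≤ √r := by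
  have heq : B * G = (B * P).submatrix id τ - B * G * ((G⁻¹ * P - W) * selector τ) := by
    rw [← mul_selector, ← Matrix.mul_assoc, h.mul_eq B, Matrix.add_mul, add_sub_cancel_right,
      Matrix.mul_assoc, h.weights.mul_selector, Matrix.mul_one]
  have hball : frobNorm ((B * P).submatrix id τ) ≤ √r := by
    refine Real.le_sqrt_of_sq_le ?_
    rw [sq_frobNorm_eq_sum_col]
    calc ∑ j, ‖colPoint ((B * P).submatrix id τ) j‖ ^ 2 ≤ ∑ _j : Fin r, (1 : ℝ) :=
          Finset.sum_le_sum fun j _ => pow_le_one₀ (norm_nonneg _) (hB (τ j))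
      _ = r := by simp only [Finset.sum_const, Finset.card_univ, Fintype.card_fin, nsmul_one]
  have htriangle := frobNorm_sub_le ((B * P).submatrix id τ)
    (B * G * ((G⁻¹ * P - W) * selector τ))
  rw [← heq] at htriangle
  have hnoise : frobNorm (B * G * ((G⁻¹ * P - W) * selector τ)) ≤ frobNorm (B * G) * η :=
    (frobNorm_mul_le _ _).trans (mul_le_mul_of_nonneg_left
      ((l2_opNorm_mul_selector_le _ h.weights.injective).trans h.noise) (frobNorm_nonneg _))
  linarith

theorem frobNorm_noise_le [NeZero r] (h : IsNearlySeparable P G W τ η)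
    {B : Matrix (Fin r) (Fin r) ℝ} (hB : ∀ i, ‖colPoint (B * P) i‖ ≤ 1) :
    frobNorm (B * G * (G⁻¹ * P - W)) ≤ 1 / 1000 := by
  have hvertices := mul_le_mul_of_nonneg_right (h.one_sub_mul_frobNorm_le hB) h.noise_nonneg
  have hnoise : frobNorm (B * G * (G⁻¹ * P - W)) ≤ frobNorm (B * G) * η :=
    (frobNorm_mul_le _ _).trans (mul_le_mul_of_nonneg_left h.noise (frobNorm_nonneg _))
  nlinarith [h.noise_le, h.small, mul_nonneg (frobNorm_nonneg (B * G)) h.noise_nonneg]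

theorem exists_isNoisyFrame [NeZero r] (h : IsNearlySeparable P G W τ η)
    (hL : MVEEOptimal (Set.range P.col) L) :
    ∃ u, IsNoisyFrame (colPoint (sqrtMatrix L hL.1.1 * G)) (colPoint (sqrtMatrix L hL.1.1 * P))
      (colPoint (sqrtMatrix L hL.1.1 * G * (G⁻¹ * P - W))) Wᵀ u τ := by
  obtain ⟨u, nonneg, active, frame⟩ := hL.exists_weights
  let B := sqrtMatrix L hL.1.1
  have eq_comb : ∀ i, colPoint (B * P) i = ∑ j, Wᵀ i j • colPoint (B * G) j +
      colPoint (B * G * (G⁻¹ * P - W)) i := fun i => by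
    rw [sum_smul_colPoint, h.mul_eq B]
    rfl
  have hball : ∀ i, ‖colPoint (B * P) i‖ ≤ 1 := fun i => by
    refine le_of_sq_le_sq ?_ zero_le_one
    rw [sq_norm_colPoint_sqrtMatrix_mul, one_pow]
    exact hL.1.2 _ ⟨i, rfl⟩
  refine ⟨u, fun i j => h.weights.nonneg j i, h.weights.sum_le, eq_comb, fun j => ?_,
    h.weights.injective, hball, nonneg, fun i hi => ?_, fun v => ?_, ?_⟩
  · have hvertex : ∀ k, W k (τ j) = (1 : Matrix (Fin r) (Fin r) ℝ) k j :=
      fun k => congrFun₂ h.weights.submatrix k j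
    rw [eq_comb]
    simp only [transpose_apply, hvertex, one_apply, ite_smul, one_smul, zero_smul,
      Finset.sum_ite_eq', Finset.mem_univ, if_true]
    rfl
  · rw [← pow_eq_one_iff_of_nonneg (norm_nonneg _) two_ne_zero, sq_norm_colPoint_sqrtMatrix_mul]
    exact active i hi
  · have hanalysis : ∀ i, analysis (colPoint (sqrtMatrix L hL.1.1 * P)) v i =
        (sqrtMatrix L hL.1.1 *ᵥ P.col i) ⬝ᵥ v.ofLp := fun i => by
      rw [analysis, EuclideanSpace.inner_eq_star_dotProduct, star_trivial, dotProduct_comm]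
      rfl
    rw [EuclideanSpace.real_norm_sq_eq]
    simpa only [hanalysis, dotProduct, ← sq] using frame v.ofLp
  · rw [← sq_frobNorm_eq_sum_col]
    exact pow_le_pow_left₀ (frobNorm_nonneg _) (h.frobNorm_noise_le hball) 2

theorem isNearSimplex [NeZero r] (h : IsNearlySeparable P G W τ η)
    (hL : MVEEOptimal (Set.range P.col) L) :
    IsNearSimplex (colPoint (sqrtMatrix L hL.1.1 * G)) (colPoint (sqrtMatrix L hL.1.1 * P)) Wᵀ τ
      (11 / 10 * η) := by
  obtain ⟨u, hu⟩ := h.exists_isNoisyFrame hL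
  have hV : Module.finrank ℝ (EuclideanSpace ℝ (Fin r)) = Fintype.card (Fin r) :=
    finrank_euclideanSpace
  have hvertices : ‖sqrtMatrix L hL.1.1 * G‖ ≤ 11 / 10 :=
    l2_opNorm_le_of_vecNorm2_mulVec_le (by norm_num) fun z => by
      rw [vecNorm2_eq_sqrt z, vecNorm2, ← sum_smul_colPoint]
      exact hu.norm_synthesis_le hV z
  have hnoise : ∀ i, ‖colPoint (sqrtMatrix L hL.1.1 * G * (G⁻¹ * P - W)) i‖ ≤ 11 / 10 * η :=
    fun i => (vecNorm2_col_le _ i).trans ((l2_opNorm_mul _ _).trans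
      (mul_le_mul hvertices h.noise (norm_nonneg _) (by norm_num)))
  refine ⟨hu.weight_nonneg, hu.weight_sum, fun i => ?_, fun j => ?_, hu.le_norm_synthesis hV,
    fun j => (vecNorm2_col_le _ j).trans hvertices, by linarith [h.noise_nonneg], ?_⟩
  · rw [hu.eq_comb i, add_sub_cancel_left]
    exact hnoise i
  · rw [hu.vertex j, add_sub_cancel_left]
    exact hnoise _
  · rw [Fintype.card_fin]
    linarith [h.small]

theorem spaTerminates [NeZero r] (h : IsNearlySeparable P G W τ η)
    (hL : MVEEOptimal (Set.range P.col) L) : SPATerminates (sqrtMatrix L hL.1.1 * P) r := by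
  simpa only [Fintype.card_fin] using (h.isNearSimplex hL).spaTerminates

theorem exists_equiv_of_spaReturns [NeZero r] (h : IsNearlySeparable P G W τ η)
    (hL : MVEEOptimal (Set.range P.col) L) {I : Finset (Fin m)}
    (hI : SPAReturns (sqrtMatrix L hL.1.1 * P) r I) :
    ∃ order : Fin r ≃ I, ∀ j, vecNorm2 (G⁻¹ *ᵥ (P.col (order j) - G.col j)) ≤ 100 * η := by
  have hsimplex := h.isNearSimplex hL
  obtain ⟨order, horder⟩ := hsimplex.exists_equiv_of_spaReturns (by rwa [Fintype.card_fin])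
  refine ⟨order, fun j => ?_⟩
  set x := G⁻¹ *ᵥ (P.col (order j) - G.col j) with hx
  have hcoord : ∑ k, x k • colPoint (sqrtMatrix L hL.1.1 * G) k =
      colPoint (sqrtMatrix L hL.1.1 * P) (order j) - colPoint (sqrtMatrix L hL.1.1 * G) j := by
    rw [sum_smul_colPoint, hx, mulVec_mulVec, mul_nonsing_inv_cancel_right _ _ h.isUnit_det,
      mulVec_sub]
    rfl
  have hlower := hsimplex.lower x
  rw [hcoord, ← vecNorm2_eq_sqrt] at hlower
  linarith [horder j]

end IsNearlySeparable

/-! ### Reduction to the column space -/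

section Reduction

variable {d m r : ℕ} {A : Matrix (Fin d) (Fin m) ℝ} {F R : Matrix (Fin d) (Fin r) ℝ}
  {W P : Matrix (Fin r) (Fin m) ℝ} {τ : Fin r → Fin m} {δ : ℝ}

namespace IsOrthonormalFactor

theorem l2_opNorm_sub_le (h : IsOrthonormalFactor A R P δ) (hW : IsVertexWeights W τ)
    (hA : ‖A - F * W‖ ≤ δ) : ‖F - R * (Rᵀ * F)‖ ≤ 3 * δ := by
  set E := (A - F * W) * selector τ with hE
  have hF : F = A * selector τ - E := by
    rw [hE, Matrix.sub_mul, Matrix.mul_assoc F, hW.mul_selector, Matrix.mul_one, sub_sub_cancel]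
  have hsplit : F - R * (Rᵀ * F) = (A - R * P) * selector τ - (E - R * (Rᵀ * E)) := by
    rw [h.eq_mul]
    nth_rw 1 2 [hF]
    simp only [Matrix.sub_mul, Matrix.mul_sub, Matrix.mul_assoc]
    abel
  have hEδ : ‖E‖ ≤ δ := (l2_opNorm_mul_selector_le _ hW.injective).trans hA
  have hRE : ‖R * (Rᵀ * E)‖ ≤ ‖E‖ :=
    (l2_opNorm_mul_le_of_transpose_mul_self h.orthonormal _).trans
      (l2_opNorm_transpose_mul_le_of_transpose_mul_self h.orthonormal E)
  rw [hsplit]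
  linarith [norm_sub_le ((A - R * P) * selector τ) (E - R * (Rᵀ * E)),
    norm_sub_le E (R * (Rᵀ * E)), l2_opNorm_mul_selector_le (A - R * P) hW.injective, h.residual]

theorem sigmaMin_sub_mul_vecNorm2_le (h : IsOrthonormalFactor A R P δ) (hW : IsVertexWeights W τ)
    (hA : ‖A - F * W‖ ≤ δ) (hF : F.rank = r) (x : Fin r → ℝ) :
    (sigmaMin F - 3 * δ) * vecNorm2 x ≤ vecNorm2 ((Rᵀ * F) *ᵥ x) := by
  have hres : vecNorm2 ((F - R * (Rᵀ * F)) *ᵥ x) ≤ 3 * δ * vecNorm2 x :=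
    (vecNorm2_mulVec_le _ _).trans
      (mul_le_mul_of_nonneg_right (h.l2_opNorm_sub_le hW hA) (vecNorm2_nonneg x))
  have htriangle := vecNorm2_add_le ((F - R * (Rᵀ * F)) *ᵥ x) (R *ᵥ (Rᵀ * F) *ᵥ x)
  rw [mulVec_mulVec, ← add_mulVec, sub_add_cancel, ← mulVec_mulVec,
    vecNorm2_mulVec_of_transpose_mul_self h.orthonormal] at htriangle
  linarith [sigmaMin_mul_vecNorm2_le hF x]

theorem isNearlySeparable [NeZero r] (h : IsOrthonormalFactor A R P δ) (hW : IsVertexWeights W τ)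
    (hA : ‖A - F * W‖ ≤ δ) (hF : F.rank = r) (hδ : 1225 * √r * δ ≤ sigmaMin F) :
    IsNearlySeparable P (Rᵀ * F) W τ (51 / 50 * δ / sigmaMin F) := by
  have hσ := sigmaMin_pos hF
  have hδ0 : 0 ≤ δ := (norm_nonneg _).trans hA
  have hr : 1 ≤ √(r : ℝ) := Real.one_le_sqrt.2 (mod_cast NeZero.one_le)
  have hδσ : 1225 * δ ≤ sigmaMin F := by nlinarith
  have hs : 0 < sigmaMin F - 3 * δ := by linarith
  have hlower := h.sigmaMin_sub_mul_vecNorm2_le hW hA hF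
  have hG := isUnit_det_of_mul_vecNorm2_le hs hlower
  refine ⟨hG, hW, ?_, ?_⟩
  · have hnoise : (Rᵀ * F)⁻¹ * P - W = (Rᵀ * F)⁻¹ * (Rᵀ * (A - F * W)) := by
      rw [Matrix.mul_sub Rᵀ, ← Matrix.mul_assoc Rᵀ F, Matrix.mul_sub,
        nonsing_inv_mul_cancel_left _ _ hG, h.eq_mul]
    rw [hnoise]
    calc ‖(Rᵀ * F)⁻¹ * (Rᵀ * (A - F * W))‖ ≤ ‖(Rᵀ * F)⁻¹‖ * ‖Rᵀ * (A - F * W)‖ := l2_opNorm_mul _ _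
      _ ≤ (sigmaMin F - 3 * δ)⁻¹ * δ := by
        gcongr
        · exact l2_opNorm_inv_le_of_mul_vecNorm2_le hs hlower
        · exact (l2_opNorm_transpose_mul_le_of_transpose_mul_self h.orthonormal _).trans hA
      _ ≤ 51 / 50 * δ / sigmaMin F := by
        rw [inv_mul_eq_div, div_le_div_iff₀ hs hσ]
        nlinarith
  · rw [mul_div_assoc', div_le_iff₀ hσ]
    linarith

theorem vecNorm2_col_sub_col_le (h : IsOrthonormalFactor A R P δ) (hW : IsVertexWeights W τ)
    (hA : ‖A - F * W‖ ≤ δ) (hG : IsUnit (Rᵀ * F).det) (i : Fin m) (j : Fin r) :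
    vecNorm2 (A.col i - F.col j) ≤
      4 * δ + sigmaMax F * vecNorm2 ((Rᵀ * F)⁻¹ *ᵥ (P.col i - (Rᵀ * F).col j)) := by
  set x := (Rᵀ * F)⁻¹ *ᵥ (P.col i - (Rᵀ * F).col j) with hx
  have hcoord : (Rᵀ * F) *ᵥ x = P.col i - (Rᵀ * F).col j := by
    rw [hx, mulVec_mulVec, mul_nonsing_inv _ hG, one_mulVec]
  have hsplit : A.col i - F.col j =
      (A - R * P).col i - (F - R * (Rᵀ * F)).col j + R *ᵥ (Rᵀ * F) *ᵥ x := by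
    rw [hcoord, mulVec_sub]
    change _ = A.col i - R *ᵥ P.col i - (F.col j - R *ᵥ (Rᵀ * F).col j) + _
    abel
  have htangent : vecNorm2 (R *ᵥ (Rᵀ * F) *ᵥ x) ≤ sigmaMax F * vecNorm2 x := by
    rw [vecNorm2_mulVec_of_transpose_mul_self h.orthonormal]
    refine (vecNorm2_mulVec_le _ _).trans (mul_le_mul_of_nonneg_right ?_ (vecNorm2_nonneg x))
    exact (l2_opNorm_transpose_mul_le_of_transpose_mul_self h.orthonormal F).trans
      (l2_opNorm_le_sigmaMax F)
  rw [hsplit]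
  linarith [vecNorm2_add_le ((A - R * P).col i - (F - R * (Rᵀ * F)).col j) (R *ᵥ (Rᵀ * F) *ᵥ x),
    vecNorm2_sub_le ((A - R * P).col i) ((F - R * (Rᵀ * F)).col j),
    (vecNorm2_col_le (A - R * P) i).trans h.residual,
    (vecNorm2_col_le (F - R * (Rᵀ * F)) j).trans (h.l2_opNorm_sub_le hW hA)]

theorem exists_equiv_of_spaReturns [NeZero r] (h : IsOrthonormalFactor A R P δ)
    (hW : IsVertexWeights W τ) (hA : ‖A - F * W‖ ≤ δ) (hF : F.rank = r)
    (hδ : 1225 * √r * δ ≤ sigmaMin F) {L : Matrix (Fin r) (Fin r) ℝ}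
    (hL : MVEEOptimal (Set.range P.col) L) {I : Finset (Fin m)}
    (hI : SPAReturns (sqrtMatrix L hL.1.1 * P) r I) :
    ∃ order : Fin r ≃ I, ∀ j, vecNorm2 (A.col (order j) - F.col j) ≤ (102 * cond F + 4) * δ := by
  have hsep := h.isNearlySeparable hW hA hF hδ
  obtain ⟨order, horder⟩ := hsep.exists_equiv_of_spaReturns hL hI
  refine ⟨order, fun j => ?_⟩
  calc vecNorm2 (A.col (order j) - F.col j)
      ≤ 4 * δ + sigmaMax F * vecNorm2 ((Rᵀ * F)⁻¹ *ᵥ (P.col (order j) - (Rᵀ * F).col j)) :=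
        h.vecNorm2_col_sub_col_le hW hA hsep.isUnit_det (order j) j
    _ ≤ 4 * δ + sigmaMax F * (100 * (51 / 50 * δ / sigmaMin F)) := by
        gcongr
        · exact LinearMap.singularValues_nonneg _ 0
        · exact horder j
    _ = (102 * cond F + 4) * δ := by
        rw [cond]
        ring

end IsOrthonormalFactor

theorem cond_nonneg (F : Matrix (Fin d) (Fin r) ℝ) : 0 ≤ cond F :=
  div_nonneg (LinearMap.singularValues_nonneg _ _) (LinearMap.singularValues_nonneg _ _)

end Reduction

end

end PrecondSPA

open PrecondSPA

theorem mainTheorem1 {d m r : ℕ} (hr : 2 ≤ r)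
    (A N : Matrix (Fin d) (Fin m) ℝ) (F : Matrix (Fin d) (Fin r) ℝ)
    (hA : PrecondSPA.IsSeparable A F)
    (ε : ℝ) (hN : PrecondSPA.norm2 N = ε)
    (hε : ε ≤ PrecondSPA.sigmaMin F / (1225 * √(r : ℝ))) :
    PrecondSPA.Terminates (A + N) r ∧
    ∀ I : Finset (Fin m), PrecondSPA.Returns (A + N) r I →
      ∃ order : Fin r ≃ I, ∀ j : Fin r,
        PrecondSPA.vecNorm2 ((A + N).col (order j) - F.col j) ≤
          (432 * PrecondSPA.cond F + 4) * ε := by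
  subst hN
  have : NeZero r := ⟨by lia⟩
  have ⟨hrm, _, _, _, _, hF, _⟩ := hA
  obtain ⟨W, τ, hW, rfl⟩ := hA.exists_isVertexWeights
  have hδ : 1225 * √r * norm2 N ≤ sigmaMin F := (le_div_iff₀' (by positivity)).1 hε
  have hnoise : norm2 (F * W + N - F * W) = norm2 N := by rw [add_sub_cancel_left]
  have hfactor : ∀ P, IsTruncatedSVD (F * W + N) r P →
      ∃ R, IsOrthonormalFactor (F * W + N) R P (norm2 N) := fun P hP =>
    hnoise ▸ hP.exists_isOrthonormalFactor ((Matrix.rank_mul_le_left F W).trans_eq hF)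
  refine ⟨⟨exists_isTruncatedSVD _ (le_min (hF ▸ F.rank_le_height) hrm), fun P hP => ?_⟩,
    fun I ⟨P, hP, L, hL, hI⟩ => ?_⟩
  · obtain ⟨R, hR⟩ := hfactor P hP
    have hsep := hR.isNearlySeparable hW hnoise.le hF hδ
    exact ⟨exists_mveeOptimal τ hsep.isUnit_det_submatrix, fun L hL => hsep.spaTerminates hL⟩
  · obtain ⟨R, hR⟩ := hfactor P hP
    obtain ⟨order, horder⟩ := hR.exists_equiv_of_spaReturns hW hnoise.le hF hδ hL hI
    refine ⟨order, fun j => (horder j).trans ?_⟩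
    gcongr
    · exact norm_nonneg _
    · exact cond_nonneg F
    · norm_num
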